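/- All graphs are finite and simple, not necessarily connected. Let $\mathbb K$ be a field. For a graph $G$, the binomial edge ideal $J_G$ is the ideal of $\mathbb K[x_i,y_i : i\in V(G)]$ generated by the binomials $x_iy_j-x_jy_i$ with $\{i,j\}\in E(G)$. It is called unmixed if all associated primes of the quotient ring by $J_G$ have the same height. For $T\subseteq V(G)$ let $G\setminus T$ be the subgraph of $G$ induced on $V(G)\setminus T$, and let $c_G(T)$ be its number of connected components. The set $T$ is a cutset of $G$ if $c_G(T\setminus\{t\})<c_G(T)$ for every $t\in T$ (so $\emptyset$ is a cutset), and a vertex $w$ is a cutpoint of $G$ if $\{w\}$ is a cutset. A vertex is free in $G$ if it belongs to exactly one maximal clique of $G$. For $w\in V(G)$, $G_w$ denotes the graph obtained from $G$ by adding all edges between distinct neighbours of $w$. - $G$ is accessible if $J_G$ is unmixed and every non-empty cutset $T$ of $G$ contains some $t$ such that $T\setminus\{t\}$ is a cutset of $G$. - $J_G$ is strongly unmixed (a recursive definition) if every connected component of $G$ is a complete graph, or if $J_G$ is unmixed and $G$ has a cutpoint $w$ such that $J_{G\setminus\{w\}}$, $J_{G_w}$ and $J_{G_w\setminus\{w\}}$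 are strongly unmixed. Let $G_1$ and $G_2$ be graphs with $V(G_1)\cap V(G_2)=\{v\}$, where $v$ is a free vertex of $G_1$ and a free vertex of $G_2$, and let $G=G_1\cup G_2$. Then: 1. $J_{G_1}$ and $J_{G_2}$ are both strongly unmixed if and only if $J_G$ is strongly unmixed; 2. $G_1$ and $G_2$ are both accessible if and only if $G$ is accessible. -/

import Mathlib

universe u

/-- The generator `x_i y_j - x_j y_i` in the polynomial ring over `K` in the variables
`x_i = X (Sum.inl i)` and `y_i = X (Sum.inr i)`, for `i` a vertex. -/
noncomputable def edgeBinomial (K : Type*) [Field K] {V : Type*} (i j : V) :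
    MvPolynomial (V ⊕ V) K :=
  MvPolynomial.X (Sum.inl i) * MvPolynomial.X (Sum.inr j)
    - MvPolynomial.X (Sum.inl j) * MvPolynomial.X (Sum.inr i)

/-- The binomial edge ideal `J_G`. Both orientations of an edge are listed as generators; they
differ by a sign, so this is the ideal generated by one binomial for each edge. -/
noncomputable def binomialEdgeIdeal (K : Type*) [Field K] {V : Type*} (G : SimpleGraph V) :
    Ideal (MvPolynomial (V ⊕ V) K) :=
  Ideal.span {f | ∃ i j : V, G.Adj i j ∧ f = edgeBinomial K i j}

/-- An ideal `I` of `R` is unmixed if all associated primes of `R ⧸ I` have the same height. -/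
def Ideal.IsUnmixed {R : Type*} [CommRing R] (I : Ideal R) : Prop :=
  ∀ P ∈ associatedPrimes R (R ⧸ I), ∀ Q ∈ associatedPrimes R (R ⧸ I), P.height = Q.height

namespace SimpleGraph

/-- The graph `G ∖ T`: the subgraph of `G` induced on the vertices outside `T`. -/
abbrev removeVerts {V : Type*} (G : SimpleGraph V) (T : Set V) : SimpleGraph (Tᶜ : Set V) :=
  G.induce Tᶜ

/-- The number `c_G(T)` of connected components of `G ∖ T`. -/
noncomputable def numComponents {V : Type*} (G : SimpleGraph V) (T : Set V) : ℕ :=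
  Nat.card (G.removeVerts T).ConnectedComponent

/-- `T` is a cutset of `G`: putting back any vertex of `T` lowers the number of components. -/
def IsCutset {V : Type*} (G : SimpleGraph V) (T : Set V) : Prop :=
  ∀ v ∈ T, G.numComponents (T \ {v}) < G.numComponents T

/-- `v` is a cutpoint of `G`: the singleton of `v` is a cutset. -/
def IsCutpoint {V : Type*} (G : SimpleGraph V) (v : V) : Prop :=
  G.IsCutset {v}

/-- `v` is a free vertex of `G`: it belongs to exactly one maximal clique. -/
def IsFreeVertex {V : Type*} (G : SimpleGraph V) (v : V) : Prop :=
  ∃! C : Set V, Maximal (fun s : Set V => G.IsClique s) C ∧ v ∈ C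

/-- The graph `G_v`, obtained from `G` by joining any two distinct neighbours of `v`. -/
def completeNeighbors {V : Type*} (G : SimpleGraph V) (v : V) : SimpleGraph V where
  Adj u w := G.Adj u w ∨ (u ≠ w ∧ G.Adj v u ∧ G.Adj v w)
  symm := ⟨fun _ _ h => h.imp (fun h => h.symm) (fun h => ⟨h.1.symm, h.2.2, h.2.1⟩)⟩
  loopless := ⟨fun u h => h.elim (G.loopless.irrefl u) (fun h => h.1 rfl)⟩

/-- `J_G` is strongly unmixed (over the field `K`): the smallest property of finite graphs such
that it holds if all connected components of `G` are complete, and it holds if `J_G` is unmixed and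
for some cutpoint `v` of `G` it holds for `G ∖ {v}`, `G_v` and `G_v ∖ {v}`. -/
inductive StronglyUnmixed (K : Type*) [Field K] : {V : Type u} → SimpleGraph V → Prop
  | of_complete {V : Type u} (G : SimpleGraph V)
      (h : ∀ c : G.ConnectedComponent, G.IsClique c.supp) : StronglyUnmixed K G
  | of_cutpoint {V : Type u} (G : SimpleGraph V)
      (hG : (binomialEdgeIdeal K G).IsUnmixed) (v : V) (hv : G.IsCutpoint v)
      (h₁ : StronglyUnmixed K (G.removeVerts {v}))
      (h₂ : StronglyUnmixed K (G.completeNeighbors v))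
      (h₃ : StronglyUnmixed K ((G.completeNeighbors v).removeVerts {v})) : StronglyUnmixed K G

/-- `G` is accessible (with `J_G` taken over the field `K`): `J_G` is unmixed, and from every
nonempty cutset one can remove some element so that a cutset remains. -/
def Accessible (K : Type*) [Field K] {V : Type*} (G : SimpleGraph V) : Prop :=
  (binomialEdgeIdeal K G).IsUnmixed ∧
    ∀ T : Set V, G.IsCutset T → T.Nonempty → ∃ t ∈ T, G.IsCutset (T \ {t})

end SimpleGraph

/-! Everything rests on the combinatorial criterion `isUnmixed_iff`: `J_G` is unmixed iff `c(T) =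
|T| + c(∅)` for every cutset `T`. It comes from writing `J_G` as the intersection of explicit primes
`P_T` (`binomialEdgeIdeal_eq_iInf`). The minimal ones are those of cutsets (`cutPrime_minimal_iff`),
and for these `height P_T = |T| + |V| - c(T)` (`height_cutPrime`).

In a gluing at a free vertex `v`, no cutset of either side contains `v`, because its neighbours
there form a clique. A cutset of `G` is therefore a cutset of `G₁` together with one of `G₂`,
possibly enlarged by `v` (`isCutset_part`, `isCutset_union`). The increases in component count on
the two sides add up (`IsGluing.numComponents_union`), and `v` raises both `|T|` and `c(T)` by one.
This transfers unmixedness, and accessibility follows by removing `v` if it lies in `T`, and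
otherwise a suitable vertex from one side.

For strong unmixedness, a cutpoint `w` of one side differs from `v`, and `G ∖ w`, `G_w`, `G_w ∖ w`
are again gluings at `v`. Induction on the two derivations reduces to complete components, where
only `v` may remain as a cutpoint. Conversely, being a side of a gluing is not stable under the
recursion for `G`, since completing at `v` mixes the sides. The weaker relation `IsFreePart` is
stable, and it is the one used in `of_isFreePart`. -/

namespace SimpleGraph

/-! ### Connectivity outside a set of vertices and the local criterion for cutsets -/

variable {V W : Type*}

/-- Two vertices are connected by a path of `G` that avoids `T` (or are equal). -/
def Conn (G : SimpleGraph V) (T : Set V) : V → V → Prop :=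
  Relation.ReflTransGen fun x y => G.Adj x y ∧ x ∉ T ∧ y ∉ T

namespace Conn

variable {G : SimpleGraph V} {T T' : Set V} {x y z : V}

lemma refl (x : V) : G.Conn T x x := Relation.ReflTransGen.refl

lemma of_adj (h : G.Adj x y) (hx : x ∉ T) (hy : y ∉ T) : G.Conn T x y :=
  Relation.ReflTransGen.single ⟨h, hx, hy⟩

lemma symm (h : G.Conn T x y) : G.Conn T y x := by
  induction h with
  | refl => exact refl _
  | tail _ h ih => exact Relation.ReflTransGen.head ⟨h.1.symm, h.2.2, h.2.1⟩ ih

lemma trans (h : G.Conn T x y) (h' : G.Conn T y z) : G.Conn T x z :=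
  Relation.ReflTransGen.trans h h'

/-- A path through `t` splits at neighbours of `t`. -/
lemma of_diff_singleton {t : V} (h : G.Conn (T \ {t}) x y) (hx : x ∉ T) :
    (y ∉ T → G.Conn T x y ∨
      ∃ n m, G.Adj t n ∧ G.Adj t m ∧ n ∉ T ∧ m ∉ T ∧ G.Conn T x n ∧ G.Conn T m y) ∧
    (y = t → t ∈ T → ∃ n, G.Adj t n ∧ n ∉ T ∧ G.Conn T x n) := by
  -- The clause for walks ending at `t` itself is what carries the induction through a visit to `t`.
  induction h with
  | refl => exact ⟨fun _ => Or.inl (refl _), fun h h' => absurd (h ▸ h') hx⟩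
  | @tail y z _ h ih =>
    obtain ⟨hyz, hy, hz⟩ := h
    by_cases hyT : y ∈ T
    · have hyt : y = t := by by_contra h'; exact hy ⟨hyT, h'⟩
      subst hyt
      obtain ⟨n, hn, hnT, hxn⟩ := ih.2 rfl hyT
      exact ⟨fun hzT => Or.inr ⟨n, z, hn, hyz, hnT, hzT, hxn, refl _⟩,
        fun h _ => absurd (h ▸ hyz) (G.irrefl)⟩
    · rcases ih.1 hyT with h1 | ⟨n, m, hn, hm, hnT, hmT, h1, h2⟩
      · refine ⟨fun hzT => Or.inl (h1.trans (of_adj hyz hyT hzT)), ?_⟩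
        rintro rfl _
        exact ⟨y, hyz.symm, hyT, h1⟩
      · refine ⟨fun hzT => Or.inr ⟨n, m, hn, hm, hnT, hmT, h1, h2.trans (of_adj hyz hyT hzT)⟩, ?_⟩
        rintro rfl _
        exact ⟨n, hn, hnT, h1⟩

lemma map {H : SimpleGraph W} (f : H →g G) {S : Set W} {a b : W} (hf : ∀ x ∉ S, f x ∉ T)
    (h : H.Conn S a b) : G.Conn T (f a) (f b) := by
  induction h with
  | refl => exact refl _
  | tail _ h ih => exact ih.trans (of_adj (f.map_adj h.1) (hf _ h.2.1) (hf _ h.2.2))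

end Conn

variable {G : SimpleGraph V} {T : Set V}

lemma removeVerts_reachable_iff (x y : (Tᶜ : Set V)) :
    (G.removeVerts T).Reachable x y ↔ G.Conn T x y := by
  rw [reachable_iff_reflTransGen]
  constructor
  · intro h
    induction h with
    | refl => exact Conn.refl _
    | @tail y z _ h ih => exact ih.trans (Conn.of_adj h y.2 z.2)
  · intro h
    obtain ⟨x, hx⟩ := x
    obtain ⟨y, hy⟩ := y
    simp only at h
    induction h with
    | refl => exact Relation.ReflTransGen.refl
    | @tail y z _ h ih => exact (ih h.2.1).tail (by exact h.1)

lemma removeVerts_mk_eq_iff (x y : (Tᶜ : Set V)) :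
    (G.removeVerts T).connectedComponentMk x = (G.removeVerts T).connectedComponentMk y ↔
      G.Conn T x y := by
  rw [ConnectedComponent.eq, removeVerts_reachable_iff]

/-- The map on components induced by putting vertices back. -/
noncomputable def componentMap (G : SimpleGraph V) {T T' : Set V} (h : T' ⊆ T) :
    (G.removeVerts T).ConnectedComponent → (G.removeVerts T').ConnectedComponent :=
  ConnectedComponent.map
    (⟨fun x => ⟨x.1, fun hx => x.2 (h hx)⟩, fun h => h⟩ : G.removeVerts T →g G.removeVerts T')

lemma componentMap_mk {T T' : Set V} (h : T' ⊆ T) (x : (Tᶜ : Set V)) :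
    G.componentMap h ((G.removeVerts T).connectedComponentMk x) =
      (G.removeVerts T').connectedComponentMk ⟨x.1, fun hx => x.2 (h hx)⟩ := rfl

lemma componentMap_mk_eq_iff {T T' : Set V} (h : T' ⊆ T) (x y : (Tᶜ : Set V)) :
    G.componentMap h ((G.removeVerts T).connectedComponentMk x) =
      G.componentMap h ((G.removeVerts T).connectedComponentMk y) ↔ G.Conn T' x y := by
  rw [componentMap_mk, componentMap_mk, removeVerts_mk_eq_iff]

/-- The only component that could be missed is that of `t`, and the neighbour `n` represents it. -/
lemma componentMap_surjective {t n : V} (hn : G.Adj t n) (hnT : n ∉ T) :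
    Function.Surjective (G.componentMap (Set.sdiff_subset : T \ {t} ⊆ T)) := by
  intro c
  induction c using ConnectedComponent.ind with
  | _ x =>
  by_cases hx : x.1 ∈ T
  · have hxt : x.1 = t := by by_contra h; exact x.2 ⟨hx, h⟩
    refine ⟨(G.removeVerts T).connectedComponentMk ⟨n, hnT⟩, ?_⟩
    rw [componentMap_mk, removeVerts_mk_eq_iff]
    exact Conn.of_adj (by rw [hxt]; exact hn.symm) (fun h => hnT h.1) x.2
  · exact ⟨(G.removeVerts T).connectedComponentMk ⟨x.1, hx⟩, rfl⟩

/-- Putting `t` back merges exactly the components containing neighbours of `t`; if there is at most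
one, the map on components is injective. -/
lemma numComponents_diff_lt_iff [Finite V] {t : V} :
    G.numComponents (T \ {t}) < G.numComponents T ↔
      ∃ x y, G.Adj t x ∧ G.Adj t y ∧ x ∉ T ∧ y ∉ T ∧ ¬ G.Conn T x y := by
  constructor
  · intro h
    by_contra! hc
    refine absurd (Nat.card_le_card_of_injective
      (G.componentMap (Set.sdiff_subset : T \ {t} ⊆ T)) ?_) (not_le.2 h)
    intro c d
    induction c using ConnectedComponent.ind with
    | _ x =>
    induction d using ConnectedComponent.ind with
    | _ y =>
    rw [componentMap_mk_eq_iff, removeVerts_mk_eq_iff]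
    intro h
    rcases (h.of_diff_singleton x.2).1 y.2 with h | ⟨n, m, hn, hm, hnT, hmT, h1, h2⟩
    · exact h
    · exact h1.trans ((hc n m hn hm hnT hmT).trans h2)
  · rintro ⟨x, y, hx, hy, hxT, hyT, hxy⟩
    have hs := componentMap_surjective (G := G) (T := T) hx hxT
    refine lt_of_le_of_ne (Nat.card_le_card_of_surjective _ hs) ?_
    intro he
    have hb := (Nat.bijective_iff_surjective_and_card _).2 ⟨hs, he.symm⟩
    have := hb.1 (a₁ := (G.removeVerts T).connectedComponentMk ⟨x, hxT⟩)
      (a₂ := (G.removeVerts T).connectedComponentMk ⟨y, hyT⟩) (by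
        rw [componentMap_mk_eq_iff]
        have htT : t ∉ T \ {t} := fun h => h.2 rfl
        exact (Conn.of_adj hx.symm (fun h => hxT h.1) htT).trans
          (Conn.of_adj hy htT (fun h => hyT h.1)))
    rw [removeVerts_mk_eq_iff] at this
    exact hxy this

/-- A set is a cutset iff each of its vertices has neighbours in two different components. -/
lemma isCutset_iff [Finite V] : G.IsCutset T ↔ ∀ t ∈ T,
    ∃ x y, G.Adj t x ∧ G.Adj t y ∧ x ∉ T ∧ y ∉ T ∧ ¬ G.Conn T x y :=
  forall₂_congr fun _ _ => numComponents_diff_lt_iff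

lemma isCutpoint_iff [Finite V] {t : V} : G.IsCutpoint t ↔
    ∃ x y, G.Adj t x ∧ G.Adj t y ∧ ¬ G.Conn {t} x y := by
  rw [IsCutpoint, isCutset_iff]
  simp only [Set.mem_singleton_iff, forall_eq]
  refine exists₂_congr fun x y => ⟨fun h => ⟨h.1, h.2.1, h.2.2.2.2⟩, fun h =>
    ⟨h.1, h.2.1, h.1.ne', h.2.1.ne', h.2.2⟩⟩

lemma isCutset_empty : G.IsCutset ∅ := fun _ h => h.elim

end SimpleGraph

/-! ### Component counts and induced subgraphs attached at a free vertex -/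

lemma Nat.card_eq_add_one_of_surjective {α β : Type*} [Finite α] (f : α → β)
    (hf : Function.Surjective f) {a b : α} (hab : a ≠ b) (hfab : f a = f b)
    (h : ∀ x y, f x = f y → x = y ∨ ((x = a ∨ x = b) ∧ (y = a ∨ y = b))) :
    Nat.card α = Nat.card β + 1 := by
  classical
  have e : Function.Bijective (fun x : {x // x ≠ a} => f x) := by
    constructor
    · rintro ⟨x, hx⟩ ⟨y, hy⟩ hxy
      have := h x y hxy
      simp only [Subtype.mk.injEq]
      aesop
    · intro y
      obtain ⟨x, rfl⟩ := hf y
      by_cases hx : x = a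
      · exact ⟨⟨b, hab.symm⟩, by simp [hx, hfab]⟩
      · exact ⟨⟨x, hx⟩, rfl⟩
  rw [← Nat.card_congr (Equiv.ofBijective _ e)]
  have := Fintype.ofFinite α
  simp only [Nat.card_eq_fintype_card, Fintype.card_subtype_compl, Fintype.card_subtype_eq]
  have : 0 < Fintype.card α := Fintype.card_pos_iff.2 ⟨a⟩
  omega

namespace SimpleGraph

variable {V W W₁ W₂ : Type*} {G : SimpleGraph V} {T : Set V}

/-- Removing `t` raises the number of components by one if `t` has neighbours in two of them. -/
lemma numComponents_eq_add_one [Finite V] {t x y : V} (hx : G.Adj t x) (hy : G.Adj t y)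
    (hxT : x ∉ T) (hyT : y ∉ T) (hxy : ¬ G.Conn T x y)
    (h : ∀ z, G.Adj t z → z ∉ T → G.Conn T z x ∨ G.Conn T z y) :
    G.numComponents T = G.numComponents (T \ {t}) + 1 := by
  refine Nat.card_eq_add_one_of_surjective _ (componentMap_surjective (G := G) (T := T) hx hxT)
    (a := (G.removeVerts T).connectedComponentMk ⟨x, hxT⟩)
    (b := (G.removeVerts T).connectedComponentMk ⟨y, hyT⟩) ?_ ?_ ?_
  · rw [Ne, removeVerts_mk_eq_iff]; exact hxy
  · rw [componentMap_mk_eq_iff]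
    have htT : t ∉ T \ {t} := fun h => h.2 rfl
    exact (Conn.of_adj hx.symm (fun h => hxT h.1) htT).trans
      (Conn.of_adj hy htT (fun h => hyT h.1))
  · intro c d
    induction c using ConnectedComponent.ind with
    | _ p =>
    induction d using ConnectedComponent.ind with
    | _ q =>
    simp only [componentMap_mk_eq_iff, removeVerts_mk_eq_iff]
    intro hpq
    rcases (hpq.of_diff_singleton p.2).1 q.2 with h' | ⟨n, m, hn, hm, hnT, hmT, h1, h2⟩
    · exact Or.inl h'
    · exact Or.inr ⟨(h n hn hnT).imp h1.trans h1.trans,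
        (h m hm hmT).imp h2.symm.trans h2.symm.trans⟩

/-- `H` sits in `G` as an induced subgraph with a vertex `a` whose neighbours in `H` form a clique,
and each vertex outside `H` with a neighbour in `H` is adjacent to `a` and to no vertices of `H`
except `a` and neighbours of `a`. -/
structure IsFreePart {H : SimpleGraph W} {G : SimpleGraph V} (f : H ↪g G) (a : W) : Prop where
  clique : ∀ x y, H.Adj a x → H.Adj a y → x ≠ y → H.Adj x y
  outside : ∀ u, u ∉ Set.range f → ∀ x, G.Adj u (f x) → G.Adj u (f a) ∧ (x = a ∨ H.Adj a x)

/-- The neighbours of `a` left outside `T` are pairwise adjacent, hence never separated. -/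
lemma notMem_of_isCutset_of_clique [Finite V] {a : V}
    (ha : ∀ x y, G.Adj a x → G.Adj a y → x ≠ y → G.Adj x y) (hT : G.IsCutset T) : a ∉ T := by
  intro haT
  obtain ⟨x, y, hx, hy, hxT, hyT, hxy⟩ := isCutset_iff.1 hT a haT
  refine hxy ?_
  by_cases h : x = y
  · exact h ▸ Conn.refl _
  · exact Conn.of_adj (ha x y hx hy h) hxT hyT

namespace IsFreePart

variable {H : SimpleGraph W} {f : H ↪g G} {a : W} {T₁ : Set W} {T₂ : Set V}

lemma notMem_union_iff (hT₂ : ∀ x, f x ∉ T₂) (x : W) : f x ∉ f '' T₁ ∪ T₂ ↔ x ∉ T₁ := by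
  simp [hT₂, f.injective.eq_iff]

/-- A walk leaves and re-enters `H` only at `a` or at neighbours of `a`, so each excursion can be
replaced by a passage through `a`. The second clause keeps track of the walk during an excursion. -/
lemma conn_aux (hf : IsFreePart f a) (ha : a ∉ T₁) (hT₂ : ∀ x, f x ∉ T₂) {x : W} {z : V}
    (h : G.Conn (f '' T₁ ∪ T₂) (f x) z) :
    (∀ y, z = f y → H.Conn T₁ x y) ∧ (z ∉ Set.range f → H.Conn T₁ x a) := by
  induction h with
  | refl => exact ⟨fun y h => f.injective h ▸ Conn.refl _, fun h => absurd ⟨x, rfl⟩ h⟩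
  | @tail y z _ h ih =>
    obtain ⟨hyz, hy, hz⟩ := h
    constructor
    · rintro z rfl
      have hzT := (notMem_union_iff hT₂ z).1 hz
      by_cases hyr : y ∈ Set.range f
      · obtain ⟨y, rfl⟩ := hyr
        exact (ih.1 y rfl).trans (Conn.of_adj (f.map_adj_iff.1 hyz)
          ((notMem_union_iff hT₂ y).1 hy) hzT)
      · have h1 := ih.2 hyr
        rcases (hf.outside y hyr z hyz).2 with rfl | h2
        · exact h1
        · exact h1.trans (Conn.of_adj h2 ha hzT)
    · intro hzr
      by_cases hyr : y ∈ Set.range f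
      · obtain ⟨y, rfl⟩ := hyr
        have h1 := ih.1 y rfl
        rcases (hf.outside z hzr y hyz.symm).2 with rfl | h2
        · exact h1
        · exact h1.trans (Conn.of_adj h2.symm ((notMem_union_iff hT₂ y).1 hy) ha)
      · exact ih.2 hyr

lemma conn_iff (hf : IsFreePart f a) (ha : a ∉ T₁) (hT₂ : ∀ x, f x ∉ T₂) {x y : W} :
    G.Conn (f '' T₁ ∪ T₂) (f x) (f y) ↔ H.Conn T₁ x y :=
  ⟨fun h => (hf.conn_aux ha hT₂ h).1 y rfl, fun h =>
    Conn.map f.toHom (fun x hx => (notMem_union_iff hT₂ x).2 hx) h⟩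

/-- Just before its first entry into `H` the walk is at a vertex adjacent to `f a`, so it can go
there directly and never meets the image of `T₁`. -/
lemma exists_conn (hf : IsFreePart f a) (ha : a ∉ T₁) (hT₂ : ∀ x, f x ∉ T₂) {z : V}
    (h : G.Conn T₂ z (f a)) : z ∉ T₂ → z ∉ Set.range f → G.Conn (f '' T₁ ∪ T₂) z (f a) := by
  have hfa : f a ∉ f '' T₁ ∪ T₂ := (notMem_union_iff hT₂ a).2 ha
  have hout : ∀ u, u ∉ T₂ → u ∉ Set.range f → u ∉ f '' T₁ ∪ T₂ := by
    rintro u hu hur (⟨x, _, rfl⟩ | hu')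
    exacts [hur ⟨x, rfl⟩, hu hu']
  induction h using Relation.ReflTransGen.head_induction_on with
  | refl => exact fun _ h => absurd ⟨a, rfl⟩ h
  | @head y z h _ ih =>
    intro hy hyr
    by_cases hzr : z ∈ Set.range f
    · obtain ⟨z, rfl⟩ := hzr
      exact Conn.of_adj (hf.outside y hyr z h.1).1 (hout y hy hyr) hfa
    · exact (Conn.of_adj h.1 (hout y hy hyr) (hout z h.2.2 hzr)).trans (ih h.2.2 hzr)

/-- The vertices outside `H` that are not connected to `H` in `G ∖ T`. -/
def farVerts (G : SimpleGraph V) (f : W → V) (a : W) (T : Set V) : Set V :=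
  {x | x ∉ Set.range f ∧ x ∉ T ∧ ¬ G.Conn T x (f a)}

lemma farVerts_closed (hf : IsFreePart f a) (hT₂ : ∀ x, f x ∉ T₂) {x y : V}
    (hx : x ∈ farVerts G f a T₂) (h : G.Adj x y) (hy : y ∉ T₂) : y ∈ farVerts G f a T₂ := by
  have hya : ¬ G.Conn T₂ y (f a) := fun h' => hx.2.2 ((Conn.of_adj h hx.2.1 hy).trans h')
  refine ⟨?_, hy, hya⟩
  rintro ⟨y, rfl⟩
  exact hx.2.2 (Conn.of_adj (hf.outside x hx.1 y h).1 hx.2.1 (hT₂ a))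

lemma farVerts_conn (hf : IsFreePart f a) (hT₂ : ∀ x, f x ∉ T₂) {x y : V}
    (hx : x ∈ farVerts G f a T₂) (h : G.Conn (f '' T₁ ∪ T₂) x y) :
    ∃ hy : y ∈ farVerts G f a T₂, (G.induce (farVerts G f a T₂)).Reachable ⟨x, hx⟩ ⟨y, hy⟩ := by
  induction h with
  | refl => exact ⟨hx, Reachable.refl _⟩
  | @tail y z _ h ih =>
    obtain ⟨hy, h1⟩ := ih
    have hz := hf.farVerts_closed hT₂ hy h.1 (fun h' => h.2.2 (Or.inr h'))
    exact ⟨hz, h1.trans (Adj.reachable (show (G.induce _).Adj ⟨y, hy⟩ ⟨z, hz⟩ from h.1))⟩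

/-- A component either meets `H`, and then cuts out one component of `H ∖ T₁`, or consists of far
vertices. The point is that the second summand does not depend on `T₁`. -/
lemma numComponents_union_eq_add [Finite V] (hf : IsFreePart f a) (ha : a ∉ T₁)
    (hT₂ : ∀ x, f x ∉ T₂) : G.numComponents (f '' T₁ ∪ T₂) =
      H.numComponents T₁ + Nat.card (G.induce (farVerts G f a T₂)).ConnectedComponent := by
  have := Finite.of_injective f f.injective
  have hN : ∀ x ∈ farVerts G f a T₂, x ∉ f '' T₁ ∪ T₂ := by
    rintro x hx (⟨y, _, rfl⟩ | h)
    exacts [hx.1 ⟨y, rfl⟩, hx.2.1 h]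
  let g₁ : H.removeVerts T₁ →g G.removeVerts (f '' T₁ ∪ T₂) :=
    ⟨fun x => ⟨f x.1, (notMem_union_iff hT₂ x.1).2 x.2⟩, fun h => f.map_adj_iff.2 h⟩
  let g₂ : G.induce (farVerts G f a T₂) →g G.removeVerts (f '' T₁ ∪ T₂) :=
    ⟨fun x => ⟨x.1, hN x.1 x.2⟩, fun h => h⟩
  rw [numComponents, numComponents, ← Nat.card_sum]
  symm
  refine Nat.card_congr (Equiv.ofBijective
    (Sum.elim (ConnectedComponent.map g₁) (ConnectedComponent.map g₂)) ⟨?_, ?_⟩)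
  · refine Function.Injective.sumElim ?_ ?_ ?_
    · intro c d
      induction c using ConnectedComponent.ind with
      | _ x =>
      induction d using ConnectedComponent.ind with
      | _ y =>
      simp only [ConnectedComponent.map_mk, removeVerts_mk_eq_iff]
      exact (hf.conn_iff ha hT₂).1
    · intro c d
      induction c using ConnectedComponent.ind with
      | _ x =>
      induction d using ConnectedComponent.ind with
      | _ y =>
      simp only [ConnectedComponent.map_mk, removeVerts_mk_eq_iff]
      exact fun h => ConnectedComponent.eq.2 (hf.farVerts_conn hT₂ x.2 h).2
    · intro c d
      induction c using ConnectedComponent.ind with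
      | _ x =>
      induction d using ConnectedComponent.ind with
      | _ y =>
      simp only [ConnectedComponent.map_mk, Ne, removeVerts_mk_eq_iff]
      exact fun h => (hf.farVerts_conn hT₂ y.2 h.symm).1.1 ⟨x.1, rfl⟩
  · intro c
    induction c using ConnectedComponent.ind with
    | _ x =>
    obtain ⟨x, hx⟩ := x
    by_cases hxr : x ∈ Set.range f
    · obtain ⟨x, rfl⟩ := hxr
      exact ⟨Sum.inl ((H.removeVerts T₁).connectedComponentMk
        ⟨x, (notMem_union_iff hT₂ x).1 hx⟩), rfl⟩
    · have hxT : x ∉ T₂ := fun h => hx (Or.inr h)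
      by_cases hc : G.Conn T₂ x (f a)
      · refine ⟨Sum.inl ((H.removeVerts T₁).connectedComponentMk ⟨a, ha⟩), ?_⟩
        simp only [Sum.elim_inl, ConnectedComponent.map_mk, removeVerts_mk_eq_iff]
        exact (hf.exists_conn ha hT₂ hc hxT hxr).symm
      · exact ⟨Sum.inr ((G.induce _).connectedComponentMk ⟨x, hxr, hxT, hc⟩), rfl⟩

lemma numComponents_union [Finite V] (hf : IsFreePart f a) (ha : a ∉ T₁)
    (hT₂ : ∀ x, f x ∉ T₂) : G.numComponents (f '' T₁ ∪ T₂) + H.numComponents ∅ =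
      H.numComponents T₁ + G.numComponents T₂ := by
  have h := hf.numComponents_union_eq_add (T₁ := ∅) (Set.notMem_empty a) hT₂
  rw [Set.image_empty, Set.empty_union] at h
  rw [hf.numComponents_union_eq_add ha hT₂, h]
  ring

lemma exists_separated [Finite V] (hf : IsFreePart f a) (hT₁ : H.IsCutset T₁)
    (hT₂ : ∀ x, f x ∉ T₂) {t : W} (ht : t ∈ T₁) : ∃ x y, G.Adj (f t) x ∧ G.Adj (f t) y ∧
      x ∉ f '' T₁ ∪ T₂ ∧ y ∉ f '' T₁ ∪ T₂ ∧ ¬ G.Conn (f '' T₁ ∪ T₂) x y := by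
  have := Finite.of_injective f f.injective
  have ha := notMem_of_isCutset_of_clique hf.clique hT₁
  obtain ⟨x, y, hx, hy, hxT, hyT, hxy⟩ := isCutset_iff.1 hT₁ t ht
  exact ⟨f x, f y, f.map_adj_iff.2 hx, f.map_adj_iff.2 hy, (notMem_union_iff hT₂ x).2 hxT,
    (notMem_union_iff hT₂ y).2 hyT, fun h => hxy ((hf.conn_iff ha hT₂).1 h)⟩

lemma isCutset_image [Finite V] (hf : IsFreePart f a) (hT₁ : H.IsCutset T₁) :
    G.IsCutset (f '' T₁) := by
  rw [isCutset_iff]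
  rintro _ ⟨t, ht, rfl⟩
  simpa only [Set.union_empty] using
    hf.exists_separated hT₁ (T₂ := ∅) (fun _ => Set.notMem_empty _) ht

end IsFreePart

/-! ### Cutsets and component counts in a gluing -/

/-- `G` is obtained from `H₁` and `H₂` by identifying the vertices `a` and `b`, whose neighbours
form cliques. -/
structure IsGluing {H₁ : SimpleGraph W₁} {H₂ : SimpleGraph W₂} {G : SimpleGraph V}
    (f₁ : H₁ ↪g G) (f₂ : H₂ ↪g G) (a : W₁) (b : W₂) : Prop where
  eq : f₁ a = f₂ b
  cover : ∀ x, x ∈ Set.range f₁ ∨ x ∈ Set.range f₂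
  inter : ∀ x y, f₁ x = f₂ y → x = a
  adj : ∀ x y, G.Adj (f₁ x) (f₂ y) → x = a ∨ y = b
  clique₁ : ∀ x y, H₁.Adj a x → H₁.Adj a y → x ≠ y → H₁.Adj x y
  clique₂ : ∀ x y, H₂.Adj b x → H₂.Adj b y → x ≠ y → H₂.Adj x y

namespace IsGluing

variable {H₁ : SimpleGraph W₁} {H₂ : SimpleGraph W₂} {f₁ : H₁ ↪g G} {f₂ : H₂ ↪g G}
  {a : W₁} {b : W₂}

lemma symm (h : IsGluing f₁ f₂ a b) : IsGluing f₂ f₁ b a where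
  eq := h.eq.symm
  cover x := (h.cover x).symm
  inter x y hxy := f₂.injective (by rw [hxy, ← h.eq, h.inter y x hxy.symm])
  adj x y hxy := (h.adj y x hxy.symm).symm
  clique₁ := h.clique₂
  clique₂ := h.clique₁

lemma isFreePart (h : IsGluing f₁ f₂ a b) : IsFreePart f₁ a where
  clique := h.clique₁
  outside := by
    intro u hu x hux
    obtain ⟨y, rfl⟩ := (h.cover u).resolve_left hu
    rcases h.adj x y hux.symm with rfl | rfl
    · exact ⟨hux, Or.inl rfl⟩
    · exact absurd ⟨a, h.eq⟩ hu

/-- The part of a set of vertices in the first graph, without the common vertex. -/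
def part (f : W → V) (a : W) (T : Set V) : Set W := {x | x ≠ a ∧ f x ∈ T}

lemma part_image_diff (h : IsGluing f₁ f₂ a b) (T : Set V) :
    f₁ '' part f₁ a T ∪ f₂ '' part f₂ b T = T \ {f₁ a} := by
  ext x
  constructor
  · rintro (⟨y, ⟨hy, hyT⟩, rfl⟩ | ⟨y, ⟨hy, hyT⟩, rfl⟩)
    · exact ⟨hyT, fun h' => hy (f₁.injective h')⟩
    · exact ⟨hyT, fun h' => hy (f₂.injective (h'.trans h.eq))⟩
  · rintro ⟨hxT, hx⟩
    rcases h.cover x with ⟨y, rfl⟩ | ⟨y, rfl⟩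
    · exact Or.inl ⟨y, ⟨fun h' => hx (by rw [h']; rfl), hxT⟩, rfl⟩
    · exact Or.inr ⟨y, ⟨fun h' => hx (by rw [h', h.eq]; rfl), hxT⟩, rfl⟩

lemma notMem_image (h : IsGluing f₁ f₂ a b) {T₂ : Set W₂} (hb : b ∉ T₂) (x : W₁) :
    f₁ x ∉ f₂ '' T₂ := by
  rintro ⟨y, hy, hxy⟩
  exact hb (h.symm.inter y x hxy ▸ hy)

/-- A neighbour of a vertex of `H₁` other than `a` lies in `H₁`. -/
lemma exists_of_adj (h : IsGluing f₁ f₂ a b) {t : W₁} (ht : t ≠ a) {x : V}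
    (hx : G.Adj (f₁ t) x) : ∃ y, x = f₁ y ∧ H₁.Adj t y := by
  rcases h.cover x with ⟨y, rfl⟩ | ⟨y, rfl⟩
  · exact ⟨y, rfl, f₁.map_adj_iff.1 hx⟩
  · obtain rfl := (h.adj t y hx).resolve_left ht
    rw [← h.eq] at hx
    exact ⟨a, h.eq.symm, f₁.map_adj_iff.1 hx⟩

/-- A vertex of the part has all its neighbours in `H₁`, so its separated neighbours are found
there. Dropping `a` from the set does not reconnect them. -/
lemma isCutset_part [Finite V] (h : IsGluing f₁ f₂ a b) (hT : G.IsCutset T) :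
    H₁.IsCutset (part f₁ a T) := by
  have := Finite.of_injective f₁ f₁.injective
  rw [isCutset_iff] at hT ⊢
  rintro t ⟨hta, htT⟩
  obtain ⟨x, y, hx, hy, hxT, hyT, hxy⟩ := hT _ htT
  obtain ⟨x, rfl, hx'⟩ := h.exists_of_adj hta hx
  obtain ⟨y, rfl, hy'⟩ := h.exists_of_adj hta hy
  refine ⟨x, y, hx', hy', fun h' => hxT h'.2, fun h' => hyT h'.2, fun hc => hxy ?_⟩
  by_cases haT : f₁ a ∈ T
  · have hS : part f₁ a T = f₁ ⁻¹' T \ {a} := by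
      ext z; exact and_comm
    rw [hS] at hc
    -- A path through `a` can be shortcut, since the neighbours of `a` in `H₁` form a clique.
    have hc' : H₁.Conn (f₁ ⁻¹' T) x y := by
      rcases (hc.of_diff_singleton hxT).1 hyT with hc | ⟨n, m, hn, hm, hnT, hmT, h1, h2⟩
      · exact hc
      · refine h1.trans (Conn.trans ?_ h2)
        by_cases hnm : n = m
        · exact hnm ▸ Conn.refl _
        · exact Conn.of_adj (h.clique₁ n m hn hm hnm) hnT hmT
    exact hc'.map f₁.toHom fun z hz => hz
  · refine hc.map f₁.toHom ?_
    intro z hz hz'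
    exact hz ⟨by rintro rfl; exact haT hz', hz'⟩

lemma isCutset_union [Finite V] (h : IsGluing f₁ f₂ a b) {T₁ : Set W₁} {T₂ : Set W₂}
    (hT₁ : H₁.IsCutset T₁) (hT₂ : H₂.IsCutset T₂) : G.IsCutset (f₁ '' T₁ ∪ f₂ '' T₂) := by
  have := Finite.of_injective f₁ f₁.injective
  have := Finite.of_injective f₂ f₂.injective
  have ha := notMem_of_isCutset_of_clique h.clique₁ hT₁
  have hb := notMem_of_isCutset_of_clique h.clique₂ hT₂
  rw [isCutset_iff]
  rintro _ (⟨t, ht, rfl⟩ | ⟨t, ht, rfl⟩)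
  · exact h.isFreePart.exists_separated hT₁ (h.notMem_image hb) ht
  · rw [Set.union_comm]
    exact h.symm.isFreePart.exists_separated hT₂ (h.symm.notMem_image ha) ht

lemma numComponents_union [Finite V] (h : IsGluing f₁ f₂ a b) {T₁ : Set W₁} {T₂ : Set W₂}
    (ha : a ∉ T₁) (hb : b ∉ T₂) :
    G.numComponents (f₁ '' T₁ ∪ f₂ '' T₂) + H₁.numComponents ∅ + H₂.numComponents ∅ =
      H₁.numComponents T₁ + H₂.numComponents T₂ + G.numComponents ∅ := by
  have h1 := h.isFreePart.numComponents_union ha (h.notMem_image hb)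
  have h2 := h.symm.isFreePart.numComponents_union (T₂ := ∅) hb fun _ => Set.notMem_empty _
  rw [Set.union_empty] at h2
  omega

lemma ncard_union [Finite V] (h : IsGluing f₁ f₂ a b) {T₁ : Set W₁} {T₂ : Set W₂}
    (hb : b ∉ T₂) : (f₁ '' T₁ ∪ f₂ '' T₂).ncard = T₁.ncard + T₂.ncard := by
  rw [Set.ncard_union_eq, Set.ncard_image_of_injective _ f₁.injective,
    Set.ncard_image_of_injective _ f₂.injective]
  rw [Set.disjoint_left]
  rintro _ ⟨x, _, rfl⟩
  exact h.notMem_image hb x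

/-- If the common vertex lies in a cutset, removing it lowers the number of components by one. -/
lemma numComponents_eq_add_one [Finite V] (h : IsGluing f₁ f₂ a b) (hT : G.IsCutset T)
    (ha : f₁ a ∈ T) : G.numComponents T = G.numComponents (T \ {f₁ a}) + 1 := by
  obtain ⟨x, y, hx, hy, hxT, hyT, hxy⟩ := isCutset_iff.1 hT _ ha
  have side₁ : ∀ p q, G.Adj (f₁ a) (f₁ p) → G.Adj (f₁ a) (f₁ q) → f₁ p ∉ T → f₁ q ∉ T →
      G.Conn T (f₁ p) (f₁ q) := by
    intro p q hp hq hpT hqT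
    rw [f₁.map_adj_iff] at hp hq
    by_cases hpq : p = q
    · exact hpq ▸ Conn.refl _
    · exact Conn.of_adj (f₁.map_adj_iff.2 (h.clique₁ p q hp hq hpq)) hpT hqT
  have side₂ : ∀ p q, G.Adj (f₁ a) (f₂ p) → G.Adj (f₁ a) (f₂ q) → f₂ p ∉ T → f₂ q ∉ T →
      G.Conn T (f₂ p) (f₂ q) := by
    intro p q hp hq hpT hqT
    rw [h.eq, f₂.map_adj_iff] at hp hq
    by_cases hpq : p = q
    · exact hpq ▸ Conn.refl _
    · exact Conn.of_adj (f₂.map_adj_iff.2 (h.clique₂ p q hp hq hpq)) hpT hqT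
  -- The remaining neighbours of the common vertex form one clique per side, so the separated pair
  -- lies on different sides and represents all of them.
  refine SimpleGraph.numComponents_eq_add_one hx hy hxT hyT hxy fun z hz hzT => ?_
  rcases h.cover x with ⟨x, rfl⟩ | ⟨x, rfl⟩ <;> rcases h.cover y with ⟨y, rfl⟩ | ⟨y, rfl⟩
  · exact absurd (side₁ x y hx hy hxT hyT) hxy
  · rcases h.cover z with ⟨z, rfl⟩ | ⟨z, rfl⟩
    · exact Or.inl (side₁ z x hz hx hzT hxT)
    · exact Or.inr (side₂ z y hz hy hzT hyT)
  · rcases h.cover z with ⟨z, rfl⟩ | ⟨z, rfl⟩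
    · exact Or.inr (side₁ z y hz hy hzT hyT)
    · exact Or.inl (side₂ z x hz hx hzT hxT)
  · exact absurd (side₂ x y hx hy hxT hyT) hxy

end IsGluing

end SimpleGraph

/-! ### The prime ideals attached to a removed set and a colouring, and their heights -/

namespace SimpleGraph

open MvPolynomial

variable {V : Type*}

section Rep

variable (G : SimpleGraph V) (T : Set V)

open Classical in
/-- A representative of the component of `x` in `G ∖ T`. -/
noncomputable def componentRep (x : V) : V :=
  if h : x ∈ T then x
  else (Quot.out ((G.removeVerts T).connectedComponentMk ⟨x, h⟩)).1

variable {G T}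

lemma componentRep_of_notMem {x : V} (h : x ∉ T) : G.componentRep T x =
    (Quot.out ((G.removeVerts T).connectedComponentMk ⟨x, h⟩)).1 := dif_neg h

lemma mk_out (C : (G.removeVerts T).ConnectedComponent) :
    (G.removeVerts T).connectedComponentMk (Quot.out C) = C := Quot.out_eq C

lemma componentRep_notMem {x : V} (h : x ∉ T) : G.componentRep T x ∉ T := by
  rw [componentRep_of_notMem h]
  exact (Quot.out ((G.removeVerts T).connectedComponentMk ⟨x, h⟩)).2

lemma componentRep_conn {x : V} (h : x ∉ T) : G.Conn T (G.componentRep T x) x := by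
  have := mk_out ((G.removeVerts T).connectedComponentMk ⟨x, h⟩)
  rw [removeVerts_mk_eq_iff] at this
  rwa [componentRep_of_notMem h]

lemma componentRep_eq_iff {x y : V} (hx : x ∉ T) (hy : y ∉ T) :
    G.componentRep T x = G.componentRep T y ↔ G.Conn T x y := by
  constructor
  · intro h
    exact (componentRep_conn hx).symm.trans (h ▸ componentRep_conn hy)
  · intro h
    rw [componentRep_of_notMem hx, componentRep_of_notMem hy,
      (removeVerts_mk_eq_iff (G := G) (T := T) ⟨x, hx⟩ ⟨y, hy⟩).2 h]

lemma componentRep_idem {x : V} (hx : x ∉ T) :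
    G.componentRep T (G.componentRep T x) = G.componentRep T x :=
  (componentRep_eq_iff (componentRep_notMem hx) hx).2 (componentRep_conn hx)

lemma ncard_componentRep_image : (G.componentRep T '' Tᶜ).ncard = G.numComponents T := by
  have hinj : Function.Injective
      (fun C : (G.removeVerts T).ConnectedComponent => (Quot.out C).1) := by
    intro C D h
    rw [← mk_out C, ← mk_out D, Subtype.ext h]
  have : G.componentRep T '' Tᶜ =
      Set.range (fun C : (G.removeVerts T).ConnectedComponent => (Quot.out C).1) := by
    ext x
    constructor
    · rintro ⟨y, hy, rfl⟩
      exact ⟨_, (componentRep_of_notMem hy).symm⟩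
    · rintro ⟨C, rfl⟩
      refine ⟨(Quot.out C).1, (Quot.out C).2, ?_⟩
      rw [componentRep_of_notMem (Quot.out C).2, Subtype.coe_eta, mk_out]
  rw [this, ← Nat.card_coe_set_eq, Nat.card_range_of_injective hinj, numComponents]

end Rep

variable (K : Type*) [Field K]

open Classical in
/-- The homomorphism sending `x_i` and `y_i` to `s_i` and `s_i t_{c i}` for `i ∉ T`, and to zero
for `i ∈ T`. -/
noncomputable def componentHom (T : Set V) (c : V → V) :
    MvPolynomial (V ⊕ V) K →ₐ[K] MvPolynomial (V ⊕ V) K :=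
  aeval (Sum.elim (fun i => if i ∈ T then 0 else X (Sum.inl i))
    (fun i => if i ∈ T then 0 else X (Sum.inl i) * X (Sum.inr (c i))))

/-- The prime ideal of algebraic relations given by a set of vertices removed and a colouring of
the others. -/
noncomputable def componentPrime (T : Set V) (c : V → V) : Ideal (MvPolynomial (V ⊕ V) K) :=
  RingHom.ker (componentHom K T c)

instance (T : Set V) (c : V → V) : (componentPrime K T c).IsPrime := RingHom.ker_isPrime _

section Prime

variable {K} {T T' : Set V} {c c' : V → V} {i j : V}

lemma mem_componentPrime {f : MvPolynomial (V ⊕ V) K} :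
    f ∈ componentPrime K T c ↔ componentHom K T c f = 0 := Iff.rfl

lemma componentHom_inl (i : V) [Decidable (i ∈ T)] :
    componentHom K T c (X (Sum.inl i)) = if i ∈ T then 0 else X (Sum.inl i) := by
  simp only [componentHom, aeval_X, Sum.elim_inl]
  congr

lemma componentHom_inr (i : V) [Decidable (i ∈ T)] : componentHom K T c (X (Sum.inr i)) =
    if i ∈ T then 0 else X (Sum.inl i) * X (Sum.inr (c i)) := by
  simp only [componentHom, aeval_X, Sum.elim_inr]
  congr

lemma inl_mem_componentPrime : X (Sum.inl i) ∈ componentPrime K T c ↔ i ∈ T := by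
  classical
  rw [mem_componentPrime, componentHom_inl]
  split_ifs with h <;> simp [h]

lemma inr_mem_componentPrime (hi : i ∈ T) : X (Sum.inr i) ∈ componentPrime K T c := by
  classical
  rw [mem_componentPrime, componentHom_inr, if_pos hi]

lemma edgeBinomial_mem_componentPrime :
    edgeBinomial K i j ∈ componentPrime K T c ↔ i ∈ T ∨ j ∈ T ∨ c i = c j := by
  classical
  simp only [mem_componentPrime, edgeBinomial, map_sub, map_mul, componentHom_inl,
    componentHom_inr]
  by_cases hi : i ∈ T
  · simp [hi]
  by_cases hj : j ∈ T
  · simp [hj]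
  simp only [hi, hj, if_false, false_or]
  have : (X (Sum.inl i) * (X (Sum.inl j) * X (Sum.inr (c j))) -
      X (Sum.inl j) * (X (Sum.inl i) * X (Sum.inr (c i))) : MvPolynomial (V ⊕ V) K) =
      X (Sum.inl i) * X (Sum.inl j) * (X (Sum.inr (c j)) - X (Sum.inr (c i))) := by ring
  rw [this, mul_eq_zero, sub_eq_zero, X_injective.eq_iff, Sum.inr.injEq, mul_eq_zero,
    or_iff_right (not_or.2 ⟨X_ne_zero _, X_ne_zero _⟩), eq_comm]

/-- A homomorphism vanishes on the ideal if the images of `x_i` and `y_i` are zero for `i ∈ T` and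
have a ratio depending only on the colour of `i` otherwise. -/
lemma componentPrime_le_ker {L : Type*} [CommRing L] [Algebra K L]
    (ψ : MvPolynomial (V ⊕ V) K →ₐ[K] L) (β : V → L)
    (h₁ : ∀ i ∈ T, ψ (X (Sum.inl i)) = 0 ∧ ψ (X (Sum.inr i)) = 0)
    (h₂ : ∀ i ∉ T, ψ (X (Sum.inr i)) = ψ (X (Sum.inl i)) * β (c i)) :
    componentPrime K T c ≤ RingHom.ker ψ := by
  classical
  have : ψ = (aeval (Sum.elim (fun i => ψ (X (Sum.inl i))) β)).comp (componentHom K T c) := by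
    refine algHom_ext fun i => ?_
    rcases i with i | i
    · rw [AlgHom.comp_apply, componentHom_inl]
      split_ifs with h
      · rw [map_zero, (h₁ i h).1]
      · simp
    · rw [AlgHom.comp_apply, componentHom_inr]
      split_ifs with h
      · rw [map_zero, (h₁ i h).2]
      · simp [h₂ i h]
  intro f hf
  rw [RingHom.mem_ker, this, AlgHom.comp_apply, mem_componentPrime.1 hf, map_zero]

lemma componentPrime_le (hT : T' ⊆ T) (h : ∀ i j, i ∉ T → j ∉ T → c' i = c' j → c i = c j) :
    componentPrime K T' c' ≤ componentPrime K T c := by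
  classical
  refine componentPrime_le_ker (componentHom K T c)
    -- A `c'`-colour determines the `c`-colour of the vertices outside `T` that carry it, so any
    -- such vertex may be chosen; the value at other colours is irrelevant.
    (fun k => if h : ∃ i, i ∉ T ∧ c' i = k then X (Sum.inr (c h.choose)) else 0) ?_ ?_
  · intro i hi
    rw [componentHom_inl, componentHom_inr, if_pos (hT hi), if_pos (hT hi)]
    exact ⟨rfl, rfl⟩
  · intro i _
    rw [componentHom_inl, componentHom_inr]
    by_cases hi : i ∈ T
    · simp [hi]
    · have h3 : ∃ j, j ∉ T ∧ c' j = c' i := ⟨i, hi, rfl⟩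
      rw [if_neg hi, if_neg hi, dif_pos h3, h i _ hi h3.choose_spec.1 h3.choose_spec.2.symm]

lemma componentPrime_le_iff : componentPrime K T' c' ≤ componentPrime K T c ↔
    T' ⊆ T ∧ ∀ i j, i ∉ T → j ∉ T → c' i = c' j → c i = c j := by
  refine ⟨fun h => ⟨fun i hi => inl_mem_componentPrime.1 (h (inl_mem_componentPrime.2 hi)),
    fun i j hi hj hij => ?_⟩, fun h => componentPrime_le h.1 h.2⟩
  have := edgeBinomial_mem_componentPrime.1
    (h (edgeBinomial_mem_componentPrime.2 (Or.inr (Or.inr hij))))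
  exact (this.resolve_left hi).resolve_left hj

end Prime

section Height

variable [Finite V] {K}

lemma height_componentPrime_lt {T T' : Set V} {c c' : V → V}
    (h : componentPrime K T' c' < componentPrime K T c) :
    (componentPrime K T' c').height + 1 ≤ (componentPrime K T c).height :=
  Order.add_one_le_of_lt (Ideal.height_strict_mono_of_isPrime h)

/-- Recolouring one of two vertices of equal colour with an unused colour gives a strictly smaller
prime with one more colour. Repeating this yields a chain of length `n`. -/
lemma le_height_componentPrime_empty (n : ℕ) (c : V → V)
    (h : Nat.card V = (Set.range c).ncard + n) :
    (n : ℕ∞) ≤ (componentPrime K ∅ c).height := by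
  classical
  induction n generalizing c with
  | zero => simp
  | succ n ih =>
    have hinj : ¬ Function.Injective c := by
      intro hc
      rw [← Nat.card_coe_set_eq, Nat.card_range_of_injective hc] at h
      omega
    have hsurj : ¬ Function.Surjective c := fun hs => hinj (Finite.injective_iff_surjective.2 hs)
    simp only [Function.Injective, Function.Surjective, not_forall] at hinj hsurj
    obtain ⟨i, j, hij, hne⟩ := hinj
    obtain ⟨k, hk⟩ := hsurj
    have hk' : k ∉ Set.range c := fun ⟨x, hx⟩ => hk ⟨x, hx⟩
    have hr : Set.range (Function.update c i k) = insert k (Set.range c) := by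
      ext x
      constructor
      · rintro ⟨y, rfl⟩
        by_cases hy : y = i
        · subst hy; simp
        · rw [Function.update_of_ne hy]; exact Or.inr ⟨y, rfl⟩
      · rintro (rfl | ⟨y, rfl⟩)
        · exact ⟨i, by simp⟩
        · by_cases hy : y = i
          · exact ⟨j, by rw [Function.update_of_ne (Ne.symm hne), hy, hij]⟩
          · exact ⟨y, by rw [Function.update_of_ne hy]⟩
    have h1 := ih (Function.update c i k) (by
      rw [hr, Set.ncard_insert_of_notMem hk' (Set.toFinite _)]; omega)
    have h2 : componentPrime K ∅ (Function.update c i k) < componentPrime K ∅ c := by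
      rw [lt_iff_le_not_ge, componentPrime_le_iff, componentPrime_le_iff]
      refine ⟨⟨subset_rfl, fun x y _ _ hxy => ?_⟩, fun h' => ?_⟩
      · by_cases hx : x = i <;> by_cases hy : y = i
        · rw [hx, hy]
        · subst hx
          rw [Function.update_self, Function.update_of_ne hy] at hxy
          exact absurd ⟨y, hxy.symm⟩ hk'
        · subst hy
          rw [Function.update_self, Function.update_of_ne hx] at hxy
          exact absurd ⟨x, hxy⟩ hk'
        · rwa [Function.update_of_ne hx, Function.update_of_ne hy] at hxy
      · have := h'.2 i j (Set.notMem_empty _) (Set.notMem_empty _) hij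
        rw [Function.update_self, Function.update_of_ne (Ne.symm hne)] at this
        exact hk' ⟨j, this.symm⟩
    push_cast
    exact (add_le_add_left h1 1).trans (height_componentPrime_lt h2)

/-- Vertices of `T` are put back one at a time, each with the colour of a vertex `u` outside `T`.
The prime shrinks strictly while the number of colours stays the same, so each step accounts for one
unit of height; this needs such a `u`. -/
lemma le_height_componentPrime (T : Set V) (c : V → V) (hT : T = ∅ ∨ ∃ u, u ∉ T) :
    ((2 * T.ncard + Tᶜ.ncard : ℕ) : ℕ∞) ≤
      (componentPrime K T c).height + ((c '' Tᶜ).ncard : ℕ) := by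
  classical
  induction T, T.toFinite using Set.Finite.induction_on generalizing c with
  | empty =>
    have hle : (Set.range c).ncard ≤ Nat.card V := by
      rw [← Set.image_univ, ← Set.ncard_univ]
      exact Set.ncard_image_le (Set.toFinite _)
    have := le_height_componentPrime_empty (K := K) (Nat.card V - (Set.range c).ncard) c (by omega)
    rw [Set.ncard_empty, Set.compl_empty, Set.ncard_univ, Set.image_univ]
    refine le_trans ?_ (add_le_add_left this _)
    norm_cast
    omega
  | @insert t S ht _ ih =>
    obtain ⟨u, hu⟩ := hT.resolve_left (Set.insert_nonempty _ _).ne_empty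
    have hut : u ≠ t := fun h => hu (Or.inl h)
    have huS : u ∉ S := fun h => hu (Or.inr h)
    have h1 := ih (Function.update c t (c u)) (Or.inr ⟨u, huS⟩)
    have h2 : componentPrime K S (Function.update c t (c u)) <
        componentPrime K (insert t S) c := by
      rw [lt_iff_le_not_ge, componentPrime_le_iff, componentPrime_le_iff]
      refine ⟨⟨Set.subset_insert _ _, fun x y hx hy hxy => ?_⟩,
        fun h' => ht (h'.1 (Set.mem_insert _ _))⟩
      rwa [Function.update_of_ne (fun h => hx (Or.inl h)),
        Function.update_of_ne (fun h => hy (Or.inl h))] at hxy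
    have himg : Function.update c t (c u) '' Sᶜ = c '' (insert t S)ᶜ := by
      ext x
      constructor
      · rintro ⟨y, hy, rfl⟩
        by_cases hyt : y = t
        · subst hyt
          exact ⟨u, hu, by simp⟩
        · exact ⟨y, fun h => h.elim hyt hy, by rw [Function.update_of_ne hyt]⟩
      · rintro ⟨y, hy, rfl⟩
        exact ⟨y, fun h => hy (Or.inr h), Function.update_of_ne (fun h => hy (Or.inl h)) _ _⟩
    have hc1 : Sᶜ.ncard = (insert t S)ᶜ.ncard + 1 := by
      rw [← Set.ncard_insert_of_notMem (a := t) (by simp)]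
      congr 1
      ext x
      by_cases hx : x = t
      · subst hx; simp [ht]
      · simp [hx]
    have h3 := height_componentPrime_lt h2
    rw [himg, hc1] at h1
    rw [Set.ncard_insert_of_notMem ht]
    calc ((2 * (S.ncard + 1) + (insert t S)ᶜ.ncard : ℕ) : ℕ∞)
        = ((2 * S.ncard + ((insert t S)ᶜ.ncard + 1) : ℕ) : ℕ∞) + 1 := by norm_cast; ring
      _ ≤ _ := add_le_add_left h1 1
      _ = (componentPrime K S (Function.update c t (c u))).height + 1 +
          ((c '' (insert t S)ᶜ).ncard : ℕ) := by ring
      _ ≤ _ := add_le_add_left h3 _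

/-- By Krull's height theorem: the prime is minimal over the ideal generated by both variables of
each vertex of `T` and one binomial for each other vertex that is not a colour representative. -/
lemma height_componentPrime_le (T : Set V) (c : V → V) (hc : ∀ i ∉ T, c i ∉ T)
    (hcc : ∀ i ∉ T, c (c i) = c i) : (componentPrime K T c).height + ((c '' Tᶜ).ncard : ℕ) ≤
      ((2 * T.ncard + Tᶜ.ncard : ℕ) : ℕ∞) := by
  classical
  set s : Set (MvPolynomial (V ⊕ V) K) := ((fun i => X (Sum.inl i)) '' T ∪
    (fun i => X (Sum.inr i)) '' T) ∪ (fun i => edgeBinomial K (c i) i) '' (Tᶜ \ c '' Tᶜ) with hs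
  have hmin : componentPrime K T c ∈ (Ideal.span s).minimalPrimes := by
    refine ⟨⟨inferInstance, ?_⟩, ?_⟩
    · rw [Ideal.span_le]
      rintro _ ((⟨i, hi, rfl⟩ | ⟨i, hi, rfl⟩) | ⟨i, hi, rfl⟩)
      · exact inl_mem_componentPrime.2 hi
      · exact inr_mem_componentPrime hi
      · exact edgeBinomial_mem_componentPrime.2 (Or.inr (Or.inr (hcc i hi.1)))
    · rintro Q ⟨hQ, hsQ⟩ hQP
      -- In the fraction field of the quotient by `Q`, the representative's `x`-variable is nonzero
      -- because `Q` lies below the prime. The binomials then force the ratio `y/x` to depend only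
      -- on the colour.
      let ψ : MvPolynomial (V ⊕ V) K →ₐ[K] FractionRing (MvPolynomial (V ⊕ V) K ⧸ Q) :=
        (IsScalarTower.toAlgHom K (MvPolynomial (V ⊕ V) K ⧸ Q) _).comp (Ideal.Quotient.mkₐ K Q)
      have hψ : ∀ f, ψ f = 0 ↔ f ∈ Q := by
        intro f
        simp only [ψ, AlgHom.comp_apply, IsScalarTower.coe_toAlgHom', Ideal.Quotient.mkₐ_eq_mk]
        rw [map_eq_zero_iff _ (IsFractionRing.injective _ _), Ideal.Quotient.eq_zero_iff_mem]
      have hle := componentPrime_le_ker (T := T) (c := c) ψ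
        (fun k => ψ (X (Sum.inr k)) / ψ (X (Sum.inl k))) ?_ ?_
      · exact fun f hf => (hψ f).1 (hle hf)
      · exact fun i hi => ⟨(hψ _).2 (hsQ (Ideal.subset_span (Or.inl (Or.inl ⟨i, hi, rfl⟩)))),
          (hψ _).2 (hsQ (Ideal.subset_span (Or.inl (Or.inr ⟨i, hi, rfl⟩))))⟩
      · intro i hi
        have hne : ψ (X (Sum.inl (c i))) ≠ 0 := fun h =>
          hc i hi (inl_mem_componentPrime.1 (hQP ((hψ _).1 h)))
        have hb : edgeBinomial K (c i) i ∈ Q := by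
          by_cases hi' : i ∈ c '' Tᶜ
          · obtain ⟨j, hj, rfl⟩ := hi'
            rw [hcc j hj, edgeBinomial, sub_self]
            exact Q.zero_mem
          · exact hsQ (Ideal.subset_span (Or.inr ⟨i, ⟨hi, hi'⟩, rfl⟩))
        rw [← hψ, edgeBinomial, map_sub, map_mul, map_mul, sub_eq_zero] at hb
        field_simp
        linear_combination hb
  have hsub : c '' Tᶜ ⊆ Tᶜ := by
    rintro _ ⟨i, hi, rfl⟩
    exact hc i hi
  have hcard : s.ncard + (c '' Tᶜ).ncard ≤ 2 * T.ncard + Tᶜ.ncard := by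
    have h1 := Set.ncard_union_le ((fun i => X (Sum.inl i)) '' T ∪ (fun i => X (Sum.inr i)) '' T)
      ((fun i => edgeBinomial K (c i) i) '' (Tᶜ \ c '' Tᶜ))
    have h2 := Set.ncard_union_le ((fun i => (X (Sum.inl i) : MvPolynomial (V ⊕ V) K)) '' T)
      ((fun i => X (Sum.inr i)) '' T)
    have h3 := Set.ncard_image_le (f := fun i => (X (Sum.inl i) : MvPolynomial (V ⊕ V) K))
      T.toFinite
    have h4 := Set.ncard_image_le (f := fun i => (X (Sum.inr i) : MvPolynomial (V ⊕ V) K))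
      T.toFinite
    have h5 := Set.ncard_image_le (f := fun i => edgeBinomial K (c i) i)
      (Tᶜ \ c '' Tᶜ).toFinite
    have h6 := Set.ncard_sdiff_add_ncard_of_subset hsub
    rw [← hs] at h1
    omega
  have hfin : s.Finite := by
    rw [hs]; exact ((T.toFinite.image _).union (T.toFinite.image _)).union
      ((Set.toFinite _).image _)
  have hle := Ideal.height_le_card_of_mem_minimalPrimes_span hfin hmin
  refine (add_le_add_left hle _).trans ?_
  exact_mod_cast hcard

end Height

end SimpleGraph

/-! ### The binomial edge ideal as an intersection of primes -/

namespace SimpleGraph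

open MvPolynomial

variable {V : Type*} {K : Type*} [Field K] {G : SimpleGraph V} {T : Set V} {c : V → V}

lemma edgeBinomial_mem {i j : V} (h : G.Adj i j) :
    edgeBinomial K i j ∈ binomialEdgeIdeal K G := Ideal.subset_span ⟨i, j, h, rfl⟩

lemma monomial_one_eq_X_mul {σ : Type*} {n : σ →₀ ℕ} {k : σ} (h : n k ≠ 0) :
    (monomial n 1 : MvPolynomial σ K) = X k * monomial (n - Finsupp.single k 1) 1 := by
  rw [X, monomial_mul, one_mul, add_tsub_cancel_of_le]
  exact Finsupp.single_le_iff.2 (Nat.one_le_iff_ne_zero.2 h)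

/-- The binomial of two connected vertices lies in `J_G` up to a monomial involving all
intermediate vertices. -/
lemma edgeBinomial_mul_monomial_mem {i j : V} (h : G.Conn T i j) (n : V ⊕ V →₀ ℕ)
    (hn : ∀ k ∉ T, k ≠ i → k ≠ j → n (Sum.inl k) ≠ 0 ∨ n (Sum.inr k) ≠ 0) :
    edgeBinomial K i j * monomial n 1 ∈ binomialEdgeIdeal K G := by
  classical
  induction h using Relation.ReflTransGen.head_induction_on generalizing n with
  | refl =>
    rw [edgeBinomial, sub_self, zero_mul]
    exact Ideal.zero_mem _
  | @head i k h _ ih =>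
    obtain ⟨hik, hi, hk⟩ := h
    by_cases hkj : k = j
    · subst hkj
      exact Ideal.mul_mem_right _ _ (edgeBinomial_mem hik)
    have key : ∀ z : V → V ⊕ V, (z = Sum.inl ∨ z = Sum.inr) → n (z k) ≠ 0 →
        edgeBinomial K i j * monomial n 1 ∈ binomialEdgeIdeal K G := by
      intro z hz hnz
      -- A Plücker-type relation. It trades the variable of `k` for that of `i`, so `i` stays
      -- occupied even if the rest of the walk returns to it.
      have hid : (X (z k) * edgeBinomial K i j : MvPolynomial (V ⊕ V) K) =
          X (z i) * edgeBinomial K k j + X (z j) * edgeBinomial K i k := by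
        rcases hz with rfl | rfl <;> simp only [edgeBinomial] <;> ring
      have hX : (X (z i) * monomial (n - Finsupp.single (z k) 1) 1 : MvPolynomial (V ⊕ V) K) =
          monomial (Finsupp.single (z i) 1 + (n - Finsupp.single (z k) 1)) 1 := by
        rw [X, monomial_mul, one_mul]
      have heq : edgeBinomial K i j * monomial n 1 = edgeBinomial K k j *
          monomial (Finsupp.single (z i) 1 + (n - Finsupp.single (z k) 1)) 1 +
          X (z j) * monomial (n - Finsupp.single (z k) 1) 1 * edgeBinomial K i k := by
        rw [← hX, monomial_one_eq_X_mul hnz]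
        linear_combination monomial (n - Finsupp.single (z k) 1) 1 * hid
      rw [heq]
      refine Ideal.add_mem _ (ih _ ?_) (Ideal.mul_mem_left _ _ (edgeBinomial_mem hik))
      intro l hl hlk hlj
      by_cases hli : l = i
      · subst hli
        rcases hz with rfl | rfl <;> simp
      · rcases hz with rfl | rfl <;>
          simpa [Finsupp.single_apply, Ne.symm hli, Ne.symm hlk] using hn l hl hli hlj
    rcases hn k hk hik.ne' hkj with h | h
    · exact key _ (Or.inl rfl) h
    · exact key _ (Or.inr rfl) h

/-- Monomials with equal degrees in each vertex and equal `y`-degrees in each component of the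
support are congruent modulo `J_G`. -/
lemma monomial_sub_monomial_mem [Fintype V] [DecidableEq V]
    (hc : ∀ i j, i ∉ T → j ∉ T → c i = c j → G.Conn T i j)
    (m' : V ⊕ V →₀ ℕ) (hT : ∀ i, i ∈ T ↔ m' (Sum.inl i) + m' (Sum.inr i) = 0)
    (N : ℕ) (m : V ⊕ V →₀ ℕ)
    (hd : ∀ i, m (Sum.inl i) + m (Sum.inr i) = m' (Sum.inl i) + m' (Sum.inr i))
    (hτ : ∀ k, ∑ i with c i = k, m (Sum.inr i) = ∑ i with c i = k, m' (Sum.inr i))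
    (hN : ∑ i, (m (Sum.inr i) - m' (Sum.inr i)) = N) :
    (monomial m 1 - monomial m' 1 : MvPolynomial (V ⊕ V) K) ∈ binomialEdgeIdeal K G := by
  induction N generalizing m with
  | zero =>
    have hle : ∀ i, m (Sum.inr i) ≤ m' (Sum.inr i) := fun i =>
      Nat.sub_eq_zero_iff_le.1 (Finset.sum_eq_zero_iff.1 hN i (Finset.mem_univ i))
    have heq : ∀ i, m (Sum.inr i) = m' (Sum.inr i) := fun i =>
      (Finset.sum_eq_sum_iff_of_le (fun j _ => hle j)).1 (hτ (c i)) i (by simp)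
    have : m = m' := by
      ext i
      rcases i with i | i
      · have := hd i
        have := heq i
        omega
      · exact heq i
    rw [this, sub_self]
    exact Ideal.zero_mem _
  | succ N ih =>
    -- Some `y`-degree is too large, hence another of the same colour is too small. Replacing `y_i
    -- x_j` by `x_i y_j` lowers the total excess `N` by one.
    obtain ⟨i, hi⟩ : ∃ i, m' (Sum.inr i) < m (Sum.inr i) := by
      by_contra! h
      rw [Finset.sum_eq_zero fun i _ => Nat.sub_eq_zero_of_le (h i)] at hN
      omega
    obtain ⟨j, hcj, hj⟩ : ∃ j, c j = c i ∧ m (Sum.inr j) < m' (Sum.inr j) := by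
      by_contra! h
      have := Finset.sum_lt_sum (s := {j | c j = c i}) (f := fun j => m' (Sum.inr j))
        (g := fun j => m (Sum.inr j)) (fun j hj => h j (by simpa using hj)) ⟨i, by simp, hi⟩
      exact absurd (hτ (c i)) this.ne'
    have hij : i ≠ j := by rintro rfl; omega
    have hdi := hd i
    have hdj := hd j
    have hiT : i ∉ T := by rw [hT]; omega
    have hjT : j ∉ T := by rw [hT]; omega
    set n := m - Finsupp.single (Sum.inr i) 1 - Finsupp.single (Sum.inl j) 1 with hn
    set m₁ := n + Finsupp.single (Sum.inl i) 1 + Finsupp.single (Sum.inr j) 1 with hm₁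
    have hm : m = n + Finsupp.single (Sum.inr i) 1 + Finsupp.single (Sum.inl j) 1 := by
      ext k
      rcases k with k | k
      · by_cases hk : k = j
        · subst hk; simp [hn]; omega
        · simp [hn, Ne.symm hk]
      · by_cases hk : k = i
        · subst hk; simp [hn]; omega
        · simp [hn, Ne.symm hk]
    have hl : ∀ k, m₁ (Sum.inl k) + (if k = j then 1 else 0) =
        m (Sum.inl k) + (if k = i then 1 else 0) := by
      intro k
      rw [hm₁, hm]
      simp [Finsupp.single_apply, eq_comm]
      omega
    have hr : ∀ k, m₁ (Sum.inr k) + (if k = i then 1 else 0) =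
        m (Sum.inr k) + (if k = j then 1 else 0) := by
      intro k
      rw [hm₁, hm]
      simp [Finsupp.single_apply, eq_comm]
      omega
    have h1 : (monomial m 1 - monomial m₁ 1 : MvPolynomial (V ⊕ V) K) ∈
        binomialEdgeIdeal K G := by
      have heq : (monomial m 1 - monomial m₁ 1 : MvPolynomial (V ⊕ V) K) =
          -(edgeBinomial K i j * monomial n 1) := by
        have e1 : (monomial m 1 : MvPolynomial (V ⊕ V) K) =
            monomial n 1 * X (Sum.inr i) * X (Sum.inl j) := by
          rw [hm, X, X, monomial_mul, monomial_mul, one_mul, one_mul]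
        have e2 : (monomial m₁ 1 : MvPolynomial (V ⊕ V) K) =
            monomial n 1 * X (Sum.inl i) * X (Sum.inr j) := by
          rw [hm₁, X, X, monomial_mul, monomial_mul, one_mul, one_mul]
        rw [e1, e2, edgeBinomial]
        ring
      rw [heq]
      refine neg_mem (edgeBinomial_mul_monomial_mem (hc i j hiT hjT hcj.symm) n ?_)
      intro k hk hki hkj
      have := hd k
      rw [hT] at hk
      simp only [hn, Finsupp.coe_tsub, Pi.sub_apply, Finsupp.single_apply, Sum.inl.injEq,
        Sum.inr.injEq, reduceCtorEq, if_false, Ne.symm hki, Ne.symm hkj]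
      omega
    have h2 := ih m₁ (fun k => by have := hl k; have := hr k; have := hd k; omega) (fun k => by
        rw [← hτ k]
        have hs : ∑ l with c l = k, (m₁ (Sum.inr l) + (if l = i then 1 else 0)) =
            ∑ l with c l = k, (m (Sum.inr l) + (if l = j then 1 else 0)) :=
          Finset.sum_congr rfl fun l _ => hr l
        rw [Finset.sum_add_distrib, Finset.sum_add_distrib, Finset.sum_ite_eq',
          Finset.sum_ite_eq'] at hs
        simp only [Finset.mem_filter, Finset.mem_univ, true_and, hcj] at hs
        omega) (by
        have hs : ∑ l, ((m₁ (Sum.inr l) - m' (Sum.inr l)) + (if l = i then 1 else 0)) =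
            ∑ l, (m (Sum.inr l) - m' (Sum.inr l)) := by
          refine Finset.sum_congr rfl fun l _ => ?_
          have := hr l
          by_cases hli : l = i
          · subst hli
            simp only [if_true, hij, if_false] at this ⊢
            omega
          · by_cases hlj : l = j
            · subst hlj
              simp only [if_true, hli, if_false] at this ⊢
              omega
            · simp only [hlj, hli, if_false] at this ⊢
              omega
        rw [Finset.sum_add_distrib, hN, Finset.sum_ite_eq'] at hs
        simpa using hs)
    have := Ideal.add_mem _ h1 h2
    rwa [sub_add_sub_cancel] at this

/-- The exponent of the image of a monomial under `componentHom`. -/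
noncomputable def componentExp [Fintype V] [DecidableEq V] (c : V → V) (m : V ⊕ V →₀ ℕ) :
    V ⊕ V →₀ ℕ :=
  Finsupp.equivFunOnFinite.symm (Sum.elim (fun i => m (Sum.inl i) + m (Sum.inr i))
    (fun k => ∑ i with c i = k, m (Sum.inr i)))

/-- The vertices none of whose variables occur in a monomial. -/
def zeroVerts (m : V ⊕ V →₀ ℕ) : Set V := {i | m (Sum.inl i) + m (Sum.inr i) = 0}

lemma componentHom_monomial [Fintype V] [DecidableEq V] {m : V ⊕ V →₀ ℕ} (a : K)
    (hT : T ⊆ zeroVerts m) :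
    componentHom K T c (monomial m a) = monomial (componentExp c m) a := by
  classical
  have h0 : ∀ i ∈ T, m (Sum.inl i) = 0 ∧ m (Sum.inr i) = 0 := fun i hi =>
    Nat.add_eq_zero_iff.1 (hT hi)
  have e1 : componentHom K T c (monomial m a) =
      C a * ((∏ i, X (Sum.inl i) ^ m (Sum.inl i)) *
        ∏ i, (X (Sum.inl i) * X (Sum.inr (c i))) ^ m (Sum.inr i)) := by
    rw [componentHom, aeval_monomial, Finsupp.prod_fintype _ _ (fun i => pow_zero _),
      Fintype.prod_sum_type]
    simp only [Sum.elim_inl, Sum.elim_inr, algebraMap_eq]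
    congr 2
    · refine Finset.prod_congr rfl fun i _ => ?_
      split_ifs with h
      · rw [(h0 i h).1, pow_zero, pow_zero]
      · rfl
    · refine Finset.prod_congr rfl fun i _ => ?_
      split_ifs with h
      · rw [(h0 i h).2, pow_zero, pow_zero]
      · rfl
  rw [e1, monomial_eq, Finsupp.prod_fintype _ _ (fun i => pow_zero _), Fintype.prod_sum_type]
  congr 1
  simp only [componentExp, Finsupp.equivFunOnFinite_symm_apply_apply, Sum.elim_inl, Sum.elim_inr,
    mul_pow, pow_add, Finset.prod_mul_distrib, mul_assoc]
  congr 2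
  rw [← Finset.prod_fiberwise (Finset.univ) c]
  refine Finset.prod_congr rfl fun k _ => ?_
  rw [← Finset.prod_pow_eq_pow_sum]
  refine Finset.prod_congr rfl fun i hi => ?_
  rw [(Finset.mem_filter.1 hi).2]

lemma componentHom_monomial_eq_zero [Fintype V] {m : V ⊕ V →₀ ℕ} (a : K)
    (hT : ¬ T ⊆ zeroVerts m) : componentHom K T c (monomial m a) = 0 := by
  classical
  obtain ⟨i, hi, hm⟩ := Set.not_subset.1 hT
  rw [componentHom, aeval_monomial, Finsupp.prod_fintype _ _ (fun i => pow_zero _)]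
  have hm' : m (Sum.inl i) ≠ 0 ∨ m (Sum.inr i) ≠ 0 := by
    by_contra! h
    exact hm (by simp [zeroVerts, h.1, h.2])
  rcases hm' with h | h
  · rw [Finset.prod_eq_zero (Finset.mem_univ (Sum.inl i)), mul_zero]
    simp [hi, h]
  · rw [Finset.prod_eq_zero (Finset.mem_univ (Sum.inr i)), mul_zero]
    simp [hi, h]

lemma zeroVerts_eq_of_componentExp_eq [Fintype V] [DecidableEq V] {m m' : V ⊕ V →₀ ℕ}
    (h : componentExp c m = componentExp c m') : zeroVerts m = zeroVerts m' := by
  ext i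
  have := DFunLike.congr_fun h (Sum.inl i)
  simp only [componentExp, Finsupp.equivFunOnFinite_symm_apply_apply, Sum.elim_inl] at this
  simp only [zeroVerts, Set.mem_ofPred_eq, this]

/-- The monomials of `f` are grouped by their set `T` of absent vertices and their image under the
homomorphism of `T`. Vanishing of that image makes the coefficients of each group sum to zero, and
the monomials of a group are congruent modulo `J_G`. -/
lemma mem_binomialEdgeIdeal_of_forall [Finite V] {c : Set V → V → V}
    (hc : ∀ T i j, i ∉ T → j ∉ T → c T i = c T j → G.Conn T i j)
    {f : MvPolynomial (V ⊕ V) K} (hf : ∀ T, f ∈ componentPrime K T (c T)) :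
    f ∈ binomialEdgeIdeal K G := by
  classical
  have := Fintype.ofFinite V
  let key : (V ⊕ V →₀ ℕ) → Set V × (V ⊕ V →₀ ℕ) := fun m =>
    (zeroVerts m, componentExp (c (zeroVerts m)) m)
  have hkey : ∀ m₀ m, key m = key m₀ ↔
      componentExp (c (zeroVerts m₀)) m = componentExp (c (zeroVerts m₀)) m₀ := by
    intro m₀ m
    constructor
    · intro h
      have h1 := congrArg Prod.fst h
      have h2 := congrArg Prod.snd h
      simp only [key] at h1 h2
      rwa [h1] at h2
    · intro h
      have h1 := zeroVerts_eq_of_componentExp_eq h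
      simp only [key, h1, h]
  rw [f.as_sum, ← Finset.sum_fiberwise_of_maps_to
    (g := key) (t := f.support.image key) (fun m hm => Finset.mem_image_of_mem _ hm)]
  refine Ideal.sum_mem _ fun κ hκ => ?_
  obtain ⟨m₀, _, rfl⟩ := Finset.mem_image.1 hκ
  have hsum : ∑ m ∈ f.support with key m = key m₀, coeff m f = 0 := by
    have h1 := mem_componentPrime.1 (hf (zeroVerts m₀))
    have h2 := congrArg (coeff (componentExp (c (zeroVerts m₀)) m₀)) h1
    rw [f.as_sum, map_sum, coeff_sum, coeff_zero] at h2
    rw [Finset.sum_filter]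
    refine (Finset.sum_congr rfl fun m _ => ?_).trans h2
    -- A monomial using a vertex of `zeroVerts m₀` maps to zero. Among the others, the image
    -- exponent records every vertex degree, so equal images already force the same group.
    by_cases hs : zeroVerts m₀ ⊆ zeroVerts m
    · rw [componentHom_monomial _ hs, coeff_monomial]
      simp only [hkey]
    · rw [componentHom_monomial_eq_zero _ hs, coeff_zero, if_neg]
      intro h
      have : zeroVerts m = zeroVerts m₀ := congrArg Prod.fst h
      exact hs this.ge
  have hsplit : ∑ m ∈ f.support with key m = key m₀, monomial m (coeff m f) =
      ∑ m ∈ f.support with key m = key m₀, C (coeff m f) * (monomial m 1 - monomial m₀ 1) := by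
    simp only [mul_sub, Finset.sum_sub_distrib, ← map_sum, hsum, map_zero, sub_zero, C_mul_monomial,
      mul_one]
  rw [hsplit]
  refine Ideal.sum_mem _ fun m hm => Ideal.mul_mem_left _ _ ?_
  have hm := (hkey m₀ m).1 (Finset.mem_filter.1 hm).2
  refine monomial_sub_monomial_mem (hc (zeroVerts m₀)) m₀ (fun _ => Iff.rfl) _ m
    (fun i => ?_) (fun k => ?_) rfl
  · exact DFunLike.congr_fun hm (Sum.inl i)
  · exact DFunLike.congr_fun hm (Sum.inr k)

variable (K G) in
/-- The prime ideal `P_T(G)`. -/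
noncomputable def cutPrime (T : Set V) : Ideal (MvPolynomial (V ⊕ V) K) :=
  componentPrime K T (G.componentRep T)

instance (T : Set V) : (cutPrime K G T).IsPrime := by unfold cutPrime; infer_instance

/-- The binomial edge ideal is the intersection of the ideals `P_T(G)`. -/
lemma binomialEdgeIdeal_eq_iInf [Finite V] : binomialEdgeIdeal K G = ⨅ T, cutPrime K G T := by
  refine le_antisymm (le_iInf fun T => ?_) fun f hf => ?_
  · rw [binomialEdgeIdeal, Ideal.span_le]
    rintro _ ⟨i, j, hij, rfl⟩
    refine edgeBinomial_mem_componentPrime.2 ?_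
    by_cases hi : i ∈ T
    · exact Or.inl hi
    by_cases hj : j ∈ T
    · exact Or.inr (Or.inl hj)
    exact Or.inr (Or.inr ((componentRep_eq_iff hi hj).2 (Conn.of_adj hij hi hj)))
  · refine mem_binomialEdgeIdeal_of_forall (c := fun T => G.componentRep T)
      (fun T i j hi hj h => (componentRep_eq_iff hi hj).1 h) fun T => ?_
    exact (Submodule.mem_iInf _).1 hf T

lemma cutPrime_le_iff {T T' : Set V} : cutPrime K G T' ≤ cutPrime K G T ↔
    T' ⊆ T ∧ ∀ i j, i ∉ T → j ∉ T → G.Conn T' i j → G.Conn T i j := by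
  rw [cutPrime, cutPrime, componentPrime_le_iff]
  refine and_congr_right fun hT => forall₄_congr fun i j hi hj => ?_
  rw [componentRep_eq_iff hi hj, componentRep_eq_iff (fun h => hi (hT h)) (fun h => hj (hT h))]

/-- `P_T(G)` is minimal among these primes iff `T` is a cutset. -/
lemma cutPrime_minimal_iff [Finite V] {T : Set V} :
    (∀ T', cutPrime K G T' ≤ cutPrime K G T → cutPrime K G T ≤ cutPrime K G T') ↔
      G.IsCutset T := by
  rw [isCutset_iff]
  constructor
  · intro h t ht
    by_contra! hc
    have hle : cutPrime K G (T \ {t}) ≤ cutPrime K G T := by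
      refine cutPrime_le_iff.2 ⟨Set.sdiff_subset, fun i j hi hj hij => ?_⟩
      rcases (hij.of_diff_singleton hi).1 hj with h | ⟨n, m, hn, hm, hnT, hmT, h1, h2⟩
      · exact h
      · exact h1.trans ((hc n m hn hm hnT hmT).trans h2)
    exact ((cutPrime_le_iff.1 (h _ hle)).1 ht).2 rfl
  · intro h T' hle
    obtain ⟨hsub, hconn⟩ := cutPrime_le_iff.1 hle
    have : T = T' := by
      refine Set.Subset.antisymm (fun t ht => ?_) hsub
      by_contra htT'
      obtain ⟨x, y, hx, hy, hxT, hyT, hxy⟩ := h t ht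
      exact hxy (hconn x y hxT hyT ((Conn.of_adj hx.symm (fun h => hxT (hsub h)) htT').trans
        (Conn.of_adj hy htT' (fun h => hyT (hsub h)))))
    rw [this]

/-- The two height bounds coincide here; a nonempty cutset leaves a vertex outside, as the lower
bound requires. -/
lemma height_cutPrime [Finite V] {T : Set V} (hT : G.IsCutset T) :
    (cutPrime K G T).height + (G.numComponents T : ℕ) = ((T.ncard + Nat.card V : ℕ) : ℕ∞) := by
  have hcard := Set.ncard_add_ncard_compl T
  have hT' : T = ∅ ∨ ∃ u, u ∉ T := by
    rcases T.eq_empty_or_nonempty with h | ⟨t, ht⟩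
    · exact Or.inl h
    · obtain ⟨x, _, _, _, hx, _⟩ := isCutset_iff.1 hT t ht
      exact Or.inr ⟨x, hx⟩
  have h1 := le_height_componentPrime (K := K) T (G.componentRep T) hT'
  have h2 := height_componentPrime_le (K := K) T (G.componentRep T)
    (fun i hi => componentRep_notMem hi) (fun i hi => componentRep_idem hi)
  rw [ncard_componentRep_image] at h1 h2
  rw [cutPrime, le_antisymm h2 h1, ← hcard, two_mul, add_assoc]

end SimpleGraph

/-! ### Associated primes and the combinatorial criterion for unmixedness -/

/-- The associated primes of a finite intersection of primes are its minimal members. -/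
lemma Ideal.mem_associatedPrimes_quotient_iInf {R ι : Type*} [CommRing R] [IsNoetherianRing R]
    [Finite ι] {P : ι → Ideal R} (hP : ∀ i, (P i).IsPrime) {Q : Ideal R} :
    Q ∈ associatedPrimes R (R ⧸ ⨅ i, P i) ↔
      ∃ i, Q = P i ∧ ∀ j, P j ≤ P i → P i ≤ P j := by
  classical
  have := Fintype.ofFinite ι
  have hle : ∀ {Q : Ideal R}, Q.IsPrime → ∀ s : Finset ι, s.inf P ≤ Q → ∃ i ∈ s, P i ≤ Q :=
    fun hQ s h => hQ.inf_le'.1 h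
  constructor
  · intro hQ
    rw [AssociatedPrimes.mem_iff, isAssociatedPrime_iff] at hQ
    obtain ⟨hQp, x, hx⟩ := hQ
    obtain ⟨f, rfl⟩ := Ideal.Quotient.mk_surjective x
    have hmem : ∀ r, r ∈ Q ↔ ∀ i, r * f ∈ P i := by
      intro r
      rw [hx, Submodule.mem_colon_singleton, Submodule.mem_bot, Algebra.smul_def,
        Ideal.Quotient.algebraMap_eq, ← map_mul, Ideal.Quotient.eq_zero_iff_mem,
        Submodule.mem_iInf]
    -- `Q` is the annihilator of the class of `f`: it lies below every `P i` that omits `f` and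
    -- contains their intersection, hence equals one of them.
    have hQP : ∀ i, f ∉ P i → Q ≤ P i := fun i hi r hr =>
      ((hP i).mem_or_mem ((hmem r).1 hr i)).resolve_right hi
    obtain ⟨i, hi, hPQ⟩ := hle hQp ({i | f ∉ P i} : Finset ι) (by
      intro r hr
      rw [hmem]
      intro i
      by_cases hi : f ∈ P i
      · exact Ideal.mul_mem_left _ _ hi
      · exact Ideal.mul_mem_right _ _ (Finset.inf_le (f := P) (by simpa using hi) hr))
    have hfi : f ∉ P i := by simpa using hi
    have hQi : Q = P i := le_antisymm (hQP i hfi) hPQ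
    exact ⟨i, hQi, fun j hj => hQi ▸ hQP j fun h => hfi (hj h)⟩
  · rintro ⟨i, rfl, hi⟩
    refine Module.associatedPrimes.minimalPrimes_annihilator_subset_associatedPrimes R _ ?_
    rw [Ideal.annihilator_quotient]
    refine ⟨⟨hP i, iInf_le _ i⟩, fun Q hQ hQi => ?_⟩
    obtain ⟨j, _, hj⟩ := hle hQ.1 Finset.univ (by rw [Finset.inf_univ_eq_iInf]; exact hQ.2)
    exact (hi j (hj.trans hQi)).trans hj

namespace SimpleGraph

variable {V : Type*} (K : Type*) [Field K] {G : SimpleGraph V}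

/-- `J_G` is unmixed iff `c(T) = |T| + c(∅)` for all cutsets `T`. -/
theorem isUnmixed_iff [Finite V] : (binomialEdgeIdeal K G).IsUnmixed ↔
    ∀ T, G.IsCutset T → G.numComponents T = T.ncard + G.numComponents ∅ := by
  have hass : ∀ Q, Q ∈ associatedPrimes _ (MvPolynomial (V ⊕ V) K ⧸ binomialEdgeIdeal K G) ↔
      ∃ T, Q = cutPrime K G T ∧ G.IsCutset T := by
    intro Q
    rw [binomialEdgeIdeal_eq_iInf, Ideal.mem_associatedPrimes_quotient_iInf fun T => inferInstance]
    simp only [cutPrime_minimal_iff]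
  have hheight : ∀ T, G.IsCutset T → ∃ n : ℕ, (cutPrime K G T).height = n ∧
      n + G.numComponents T = T.ncard + Nat.card V := by
    intro T hT
    have h := height_cutPrime (K := K) hT
    have hne : (cutPrime K G T).height ≠ ⊤ := by
      intro h'
      rw [h', top_add] at h
      exact ENat.natCast_ne_top _ h.symm
    obtain ⟨n, hn⟩ := ENat.ne_top_iff_exists.1 hne
    rw [← hn] at h
    exact ⟨n, hn.symm, by exact_mod_cast h⟩
  obtain ⟨n₀, hn₀, hc₀⟩ := hheight ∅ isCutset_empty
  rw [Set.ncard_empty] at hc₀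
  constructor
  · intro h T hT
    obtain ⟨n, hn, hc⟩ := hheight T hT
    have := h _ ((hass _).2 ⟨T, rfl, hT⟩) _ ((hass _).2 ⟨∅, rfl, isCutset_empty⟩)
    rw [hn, hn₀, Nat.cast_inj] at this
    omega
  · intro h P hP Q hQ
    obtain ⟨T, rfl, hT⟩ := (hass P).1 hP
    obtain ⟨T', rfl, hT'⟩ := (hass Q).1 hQ
    obtain ⟨n, hn, hc⟩ := hheight T hT
    obtain ⟨n', hn', hc'⟩ := hheight T' hT'
    have := h T hT
    have := h T' hT'
    rw [hn, hn', Nat.cast_inj]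
    omega

end SimpleGraph

/-! ### Free parts and gluings under vertex removal and completion of neighbourhoods -/

namespace SimpleGraph

section Embeddings

variable {V W W₁ W₂ : Type*} {G : SimpleGraph V} {H : SimpleGraph W}

/-- The embedding of graphs obtained by removing a vertex on both sides. -/
def Embedding.removeVert (f : H ↪g G) (w : W) : H.removeVerts {w} ↪g G.removeVerts {f w} where
  toFun x := ⟨f x.1, fun h => x.2 (f.injective h)⟩
  inj' _ _ h := Subtype.ext (f.injective (congrArg Subtype.val h))
  map_rel_iff' := f.map_adj_iff

/-- The embedding into the graph without a vertex not in the image. -/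
def Embedding.toRemoveVert (f : H ↪g G) (w : V) (hw : w ∉ Set.range f) :
    H ↪g G.removeVerts {w} where
  toFun x := ⟨f x, fun h => hw ⟨x, h⟩⟩
  inj' _ _ h := f.injective (congrArg Subtype.val h)
  map_rel_iff' := f.map_adj_iff

/-- The embedding obtained by joining the neighbours of a vertex on both sides. -/
def Embedding.completeNeighbors (f : H ↪g G) (w : W) :
    H.completeNeighbors w ↪g G.completeNeighbors (f w) where
  toFun := f
  inj' := f.injective
  map_rel_iff' := by
    intro x y
    change G.Adj (f x) (f y) ∨ (f x ≠ f y ∧ G.Adj (f w) (f x) ∧ G.Adj (f w) (f y)) ↔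
      H.Adj x y ∨ (x ≠ y ∧ H.Adj w x ∧ H.Adj w y)
    rw [f.map_adj_iff, f.map_adj_iff, f.map_adj_iff, f.injective.ne_iff]

/-- The embedding of `H` into `G_w` if the neighbours of `w` in `H` are pairwise adjacent. -/
def Embedding.toCompleteNeighbors (f : H ↪g G) (w : V)
    (hw : ∀ x y, G.Adj w (f x) → G.Adj w (f y) → x ≠ y → H.Adj x y) :
    H ↪g G.completeNeighbors w where
  toFun := f
  inj' := f.injective
  map_rel_iff' := by
    intro x y
    change G.Adj (f x) (f y) ∨ (f x ≠ f y ∧ G.Adj w (f x) ∧ G.Adj w (f y)) ↔ H.Adj x y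
    rw [f.map_adj_iff, f.injective.ne_iff]
    exact or_iff_left_of_imp fun h => hw x y h.2.1 h.2.2 h.1

/-- If `a` is adjacent to `w`, all its new neighbours lie in the closed neighbourhood of `w`, which
becomes a clique; otherwise its neighbourhood is unchanged. -/
lemma completeNeighbors_clique {a w : V} (haw : w ≠ a)
    (ha : ∀ x y, G.Adj a x → G.Adj a y → x ≠ y → G.Adj x y) (x y : V)
    (hx : (G.completeNeighbors w).Adj a x) (hy : (G.completeNeighbors w).Adj a y) (hxy : x ≠ y) :
    (G.completeNeighbors w).Adj x y := by
  by_cases hwa : G.Adj w a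
  · have key : ∀ z, (G.completeNeighbors w).Adj a z → z = w ∨ G.Adj w z := by
      rintro z (h | h)
      · by_cases hz : w = z
        · exact Or.inl hz.symm
        · exact Or.inr (ha w z hwa.symm h hz)
      · exact Or.inr h.2.2
    rcases key x hx with rfl | hx' <;> rcases key y hy with rfl | hy'
    · exact absurd rfl hxy
    · exact Or.inl hy'
    · exact Or.inl hx'.symm
    · exact Or.inr ⟨hxy, hx', hy'⟩
  · exact Or.inl (ha x y (hx.resolve_right fun h => hwa h.2.1)
      (hy.resolve_right fun h => hwa h.2.1) hxy)

namespace IsFreePart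

variable {f : H ↪g G} {a : W}

lemma clique_self (hf : IsFreePart f a) (x y : W) (hx : G.Adj (f a) (f x))
    (hy : G.Adj (f a) (f y)) (hxy : x ≠ y) : H.Adj x y :=
  hf.clique x y (f.map_adj_iff.1 hx) (f.map_adj_iff.1 hy) hxy

lemma adj_of_outside (hf : IsFreePart f a) {w : V} (hw : w ∉ Set.range f) (x y : W)
    (hx : G.Adj w (f x)) (hy : G.Adj w (f y)) (hxy : x ≠ y) : H.Adj x y := by
  rcases (hf.outside w hw x hx).2 with rfl | hx' <;> rcases (hf.outside w hw y hy).2 with rfl | hy'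
  · exact absurd rfl hxy
  · exact hy'
  · exact hx'.symm
  · exact hf.clique x y hx' hy' hxy

lemma toCompleteNeighbors_self (hf : IsFreePart f a) :
    IsFreePart (f.toCompleteNeighbors (f a) hf.clique_self) a where
  clique := hf.clique
  outside := by
    intro u hu x hux
    change G.Adj u (f x) ∨ (u ≠ f x ∧ G.Adj (f a) u ∧ G.Adj (f a) (f x)) at hux
    rcases hux with h | ⟨-, h1, h2⟩
    · exact ⟨Or.inl (hf.outside u hu x h).1, (hf.outside u hu x h).2⟩
    · exact ⟨Or.inl h1.symm, Or.inr (f.map_adj_iff.1 h2)⟩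

lemma toCompleteNeighbors (hf : IsFreePart f a) {w : V} (hw : w ∉ Set.range f) :
    IsFreePart (f.toCompleteNeighbors w (hf.adj_of_outside hw)) a where
  clique := hf.clique
  outside := by
    intro u hu x hux
    change G.Adj u (f x) ∨ (u ≠ f x ∧ G.Adj w u ∧ G.Adj w (f x)) at hux
    rcases hux with h | ⟨-, h1, h2⟩
    · exact ⟨Or.inl (hf.outside u hu x h).1, (hf.outside u hu x h).2⟩
    · refine ⟨Or.inr ⟨fun h => hu ⟨a, h.symm⟩, h1, (hf.outside w hw x h2).1⟩,
        (hf.outside w hw x h2).2⟩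

lemma completeNeighbors (hf : IsFreePart f a) {w : W} (hw : w ≠ a) :
    IsFreePart (f.completeNeighbors w) a where
  clique := completeNeighbors_clique hw hf.clique
  outside := by
    intro u hu x hux
    change G.Adj u (f x) ∨ (u ≠ f x ∧ G.Adj (f w) u ∧ G.Adj (f w) (f x)) at hux
    rcases hux with h | ⟨-, h1, h2⟩
    · exact ⟨Or.inl (hf.outside u hu x h).1, (hf.outside u hu x h).2.imp_right Or.inl⟩
    · obtain ⟨h3, h4⟩ := hf.outside u hu w h1.symm
      refine ⟨Or.inl h3, ?_⟩
      by_cases hx : x = a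
      · exact Or.inl hx
      · exact Or.inr (Or.inr ⟨Ne.symm hx, (h4.resolve_left hw).symm, f.map_adj_iff.1 h2⟩)

lemma removeVert (hf : IsFreePart f a) {w : W} (hw : a ≠ w) :
    IsFreePart (f.removeVert w) ⟨a, hw⟩ where
  clique x y hx hy hxy := hf.clique x.1 y.1 hx hy fun h => hxy (Subtype.ext h)
  outside := by
    rintro ⟨u, hu⟩ hur ⟨x, hx⟩ hux
    have hur' : u ∉ Set.range f := by
      rintro ⟨y, rfl⟩
      exact hur ⟨⟨y, fun h => hu (congrArg f h)⟩, rfl⟩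
    obtain ⟨h1, h2⟩ := hf.outside u hur' x hux
    exact ⟨h1, h2.imp_left fun h => Subtype.ext h⟩

lemma isUnmixed (K : Type*) [Field K] [Finite V] (hf : IsFreePart f a)
    (hG : (binomialEdgeIdeal K G).IsUnmixed) : (binomialEdgeIdeal K H).IsUnmixed := by
  have := Finite.of_injective f f.injective
  rw [isUnmixed_iff] at hG ⊢
  intro T hT
  have h1 := hG _ (hf.isCutset_image hT)
  have h2 := hf.numComponents_union (T₂ := ∅) (notMem_of_isCutset_of_clique hf.clique hT)
    fun _ => Set.notMem_empty _
  rw [Set.union_empty] at h2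
  rw [Set.ncard_image_of_injective _ f.injective] at h1
  omega

lemma isCutpoint_of_map [Finite V] (hf : IsFreePart f a) {w : W} (hw : w ≠ a)
    (h : G.IsCutpoint (f w)) : H.IsCutpoint w := by
  have := Finite.of_injective f f.injective
  rw [isCutpoint_iff] at h ⊢
  obtain ⟨x, y, hx, hy, hxy⟩ := h
  -- A neighbour of `f w` outside `H` is adjacent to `f a`, and `w` is adjacent to `a`, so `a` can
  -- stand in for it.
  have key : ∀ x, G.Adj (f w) x → ∃ z, H.Adj w z ∧ G.Conn {f w} (f z) x := by
    intro x hx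
    by_cases hxr : x ∈ Set.range f
    · obtain ⟨x, rfl⟩ := hxr
      exact ⟨x, f.map_adj_iff.1 hx, Conn.refl _⟩
    · obtain ⟨h1, h2⟩ := hf.outside x hxr w hx.symm
      exact ⟨a, (h2.resolve_left hw).symm,
        Conn.of_adj h1.symm (fun h => hw (f.injective h).symm) fun h => hxr ⟨w, h.symm⟩⟩
  obtain ⟨x', hx', hxx⟩ := key x hx
  obtain ⟨y', hy', hyy⟩ := key y hy
  refine ⟨x', y', hx', hy', fun hc => hxy (hxx.symm.trans (Conn.trans ?_ hyy))⟩
  exact hc.map (T := {f w}) f.toHom fun z hz h => hz (f.injective h)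

end IsFreePart

namespace IsGluing

variable {H₁ : SimpleGraph W₁} {H₂ : SimpleGraph W₂} {f₁ : H₁ ↪g G} {f₂ : H₂ ↪g G}
  {a : W₁} {b : W₂}

lemma notMem_range (h : IsGluing f₁ f₂ a b) {w : W₁} (hw : w ≠ a) : f₁ w ∉ Set.range f₂ :=
  fun ⟨y, hy⟩ => hw (h.inter w y hy.symm)

lemma removeVert (h : IsGluing f₁ f₂ a b) {w : W₁} (hw : w ≠ a) :
    IsGluing (f₁.removeVert w) (f₂.toRemoveVert (f₁ w) (h.notMem_range hw)) ⟨a, hw.symm⟩ b where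
  eq := Subtype.ext h.eq
  cover := by
    rintro ⟨x, hx⟩
    rcases h.cover x with ⟨y, rfl⟩ | ⟨y, rfl⟩
    · exact Or.inl ⟨⟨y, fun h' => hx (congrArg f₁ h')⟩, rfl⟩
    · exact Or.inr ⟨y, rfl⟩
  inter x y hxy := Subtype.ext (h.inter x.1 y (congrArg Subtype.val hxy))
  adj x y hxy := (h.adj x.1 y hxy).imp_left fun h => Subtype.ext h
  clique₁ x y hx hy hxy := h.clique₁ x.1 y.1 hx hy fun h => hxy (Subtype.ext h)
  clique₂ := h.clique₂

lemma completeNeighbors (h : IsGluing f₁ f₂ a b) {w : W₁} (hw : w ≠ a) :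
    IsGluing (f₁.completeNeighbors w) (f₂.toCompleteNeighbors (f₁ w)
      (h.symm.isFreePart.adj_of_outside (h.notMem_range hw))) a b where
  eq := h.eq
  cover := h.cover
  inter := h.inter
  adj := by
    intro x y hxy
    change G.Adj (f₁ x) (f₂ y) ∨ (f₁ x ≠ f₂ y ∧ G.Adj (f₁ w) (f₁ x) ∧ G.Adj (f₁ w) (f₂ y)) at hxy
    rcases hxy with h' | ⟨-, -, h'⟩
    · exact h.adj x y h'
    · exact Or.inr ((h.adj w y h').resolve_left hw)
  clique₁ := completeNeighbors_clique hw h.clique₁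
  clique₂ := h.clique₂

lemma isUnmixed (K : Type*) [Field K] [Finite V] (h : IsGluing f₁ f₂ a b)
    (h₁ : (binomialEdgeIdeal K H₁).IsUnmixed) (h₂ : (binomialEdgeIdeal K H₂).IsUnmixed) :
    (binomialEdgeIdeal K G).IsUnmixed := by
  have := Finite.of_injective f₁ f₁.injective
  have := Finite.of_injective f₂ f₂.injective
  rw [isUnmixed_iff] at h₁ h₂ ⊢
  intro T hT
  have ha : a ∉ part f₁ a T := fun h => h.1 rfl
  have hb : b ∉ part f₂ b T := fun h => h.1 rfl
  have e₁ := h₁ _ (h.isCutset_part hT)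
  have e₂ := h₂ _ (h.symm.isCutset_part hT)
  have e₃ := h.numComponents_union ha hb
  have e₄ := h.ncard_union (T₁ := part f₁ a T) hb
  rw [h.part_image_diff] at e₃ e₄
  by_cases hv : f₁ a ∈ T
  · have e₅ := h.numComponents_eq_add_one hT hv
    have e₆ := Set.ncard_sdiff_singleton_add_one hv T.toFinite
    omega
  · rw [Set.sdiff_singleton_eq_self hv] at e₃ e₄
    omega

lemma isCutpoint_map [Finite V] (h : IsGluing f₁ f₂ a b) {w : W₁} (hw : H₁.IsCutpoint w) :
    G.IsCutpoint (f₁ w) := by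
  have := h.isFreePart.isCutset_image hw
  rwa [Set.image_singleton] at this

end IsGluing

/-- A graph in which being adjacent or equal is transitive has complete components. -/
lemma isClique_supp_of_trans (h : ∀ x y z, G.Adj x y → G.Adj y z → x ≠ z → G.Adj x z)
    (c : G.ConnectedComponent) : G.IsClique c.supp := by
  intro x hx y hy hxy
  have hr : G.Reachable x y := ConnectedComponent.exact (hx.trans hy.symm)
  rw [reachable_iff_reflTransGen] at hr
  have : x = y ∨ G.Adj x y := by
    clear hxy hy
    induction hr with
    | refl => exact Or.inl rfl
    | @tail y z _ hyz ih =>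
      by_cases hxz : x = z
      · exact Or.inl hxz
      · rcases ih with rfl | ih
        · exact Or.inr hyz
        · exact Or.inr (h x y z ih hyz hxz)
  exact this.resolve_left hxy

lemma trans_of_isClique_supp (h : ∀ c : G.ConnectedComponent, G.IsClique c.supp) (x y z : V)
    (hxy : G.Adj x y) (hyz : G.Adj y z) (hxz : x ≠ z) : G.Adj x z :=
  h (G.connectedComponentMk x) rfl
    (ConnectedComponent.sound (hxy.reachable.trans hyz.reachable).symm) hxz

lemma eq_or_adj_of_conn {T : Set V}
    (h : ∀ x y z, y ∉ T → G.Adj x y → G.Adj y z → x ≠ z → G.Adj x z) {x y : V}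
    (hxy : G.Conn T x y) : x = y ∨ G.Adj x y := by
  induction hxy with
  | refl => exact Or.inl rfl
  | @tail y z _ hyz ih =>
    by_cases hxz : x = z
    · exact Or.inl hxz
    · rcases ih with rfl | ih
      · exact Or.inr hyz.1
      · exact Or.inr (h x y z hyz.2.1 ih hyz.1 hxz)

lemma isUnmixed_of_trans (K : Type*) [Field K] [Finite V]
    (h : ∀ x y z, G.Adj x y → G.Adj y z → x ≠ z → G.Adj x z) :
    (binomialEdgeIdeal K G).IsUnmixed := by
  rw [isUnmixed_iff]
  intro T hT
  have : T = ∅ := Set.eq_empty_of_forall_notMem fun t =>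
    notMem_of_isCutset_of_clique (fun x y hx hy hxy => h x t y hx.symm hy hxy) hT
  rw [this, Set.ncard_empty, zero_add]

end Embeddings

/-! ### Strong unmixedness of free parts and of gluings -/

namespace StronglyUnmixed

variable {K : Type*} [Field K]

lemma isUnmixed {V : Type u} [Finite V] {G : SimpleGraph V} (h : G.StronglyUnmixed K) :
    (binomialEdgeIdeal K G).IsUnmixed := by
  cases h with
  | of_complete _ h => exact isUnmixed_of_trans K (trans_of_isClique_supp h)
  | of_cutpoint _ hG => exact hG

/-- Induction on the derivation for `G`. A cutpoint in `H` other than `a` serves as a cutpoint of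
`H`. If the cutpoint is `f a` or lies outside `H`, completing its neighbourhood leaves `H` unchanged
as a free part, so the hypothesis for `G_v` alone suffices. -/
lemma of_isFreePart {V : Type u} {G : SimpleGraph V} (hG : G.StronglyUnmixed K) :
    ∀ [Finite V] {W : Type u} {H : SimpleGraph W} {f : H ↪g G} {a : W}, IsFreePart f a →
      H.StronglyUnmixed K := by
  induction hG with
  | of_complete G h =>
    intro _ W H f a _
    refine of_complete H (isClique_supp_of_trans fun x y z hxy hyz hxz => ?_)
    exact f.map_adj_iff.1 (trans_of_isClique_supp h _ _ _ (f.map_adj_iff.2 hxy)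
      (f.map_adj_iff.2 hyz) (f.injective.ne hxz))
  | of_cutpoint G hG v hv _ _ _ ih₁ ih₂ ih₃ =>
    intro _ W H f a hf
    by_cases hvr : v ∈ Set.range f
    · obtain ⟨w, rfl⟩ := hvr
      by_cases hwa : w = a
      · subst hwa
        exact ih₂ hf.toCompleteNeighbors_self
      · exact of_cutpoint H (hf.isUnmixed K hG) w (hf.isCutpoint_of_map hwa hv)
          (ih₁ (hf.removeVert (Ne.symm hwa))) (ih₂ (hf.completeNeighbors hwa))
          (ih₃ ((hf.completeNeighbors hwa).removeVert (Ne.symm hwa)))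
    · exact ih₂ (hf.toCompleteNeighbors hvr)

section Gluing

variable {W₁ W₂ : Type u}

lemma of_isGluing_of_complete {V : Type u} [Finite V] {G : SimpleGraph V} {H₁ : SimpleGraph W₁}
    {H₂ : SimpleGraph W₂} {f₁ : H₁ ↪g G} {f₂ : H₂ ↪g G} {a : W₁} {b : W₂}
    (h : IsGluing f₁ f₂ a b) (h₁ : ∀ c : H₁.ConnectedComponent, H₁.IsClique c.supp)
    (h₂ : ∀ c : H₂.ConnectedComponent, H₂.IsClique c.supp) : G.StronglyUnmixed K := by
  have := Finite.of_injective f₁ f₁.injective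
  have := Finite.of_injective f₂ f₂.injective
  -- Adjacency can fail to be transitive only at the common vertex. Either it is transitive there
  -- too, or that vertex is a cutpoint and all three derived graphs have complete components.
  have htrans : ∀ x y z, y ∉ ({f₁ a} : Set V) → G.Adj x y → G.Adj y z → x ≠ z → G.Adj x z := by
    intro x y z hy hxy hyz hxz
    rcases h.cover y with ⟨y, rfl⟩ | ⟨y, rfl⟩
    · have hya : y ≠ a := fun h => hy (congrArg f₁ h)
      obtain ⟨x, rfl, hx⟩ := h.exists_of_adj hya hxy.symm
      obtain ⟨z, rfl, hz⟩ := h.exists_of_adj hya hyz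
      exact f₁.map_adj_iff.2 (trans_of_isClique_supp h₁ x y z hx.symm hz
        fun h => hxz (congrArg f₁ h))
    · have hyb : y ≠ b := fun h' => hy ((congrArg f₂ h').trans h.eq.symm)
      obtain ⟨x, rfl, hx⟩ := h.symm.exists_of_adj hyb hxy.symm
      obtain ⟨z, rfl, hz⟩ := h.symm.exists_of_adj hyb hyz
      exact f₂.map_adj_iff.2 (trans_of_isClique_supp h₂ x y z hx.symm hz
        fun h => hxz (congrArg f₂ h))
  have htrans' : ∀ x y, y ≠ f₁ a → x ≠ f₁ a → G.Adj x y → G.Adj (f₁ a) y → G.Adj (f₁ a) x :=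
    fun x y hy hx hxy hay => htrans _ y _ hy hay hxy.symm hx.symm
  by_cases hcl : ∀ x y, G.Adj (f₁ a) x → G.Adj (f₁ a) y → x ≠ y → G.Adj x y
  · refine of_complete G (isClique_supp_of_trans fun x y z hxy hyz hxz => ?_)
    by_cases hy : y = f₁ a
    · subst hy
      exact hcl x z hxy.symm hyz hxz
    · exact htrans x y z hy hxy hyz hxz
  · push Not at hcl
    obtain ⟨p, q, hp, hq, hpq, hnpq⟩ := hcl
    have hcut : G.IsCutpoint (f₁ a) := isCutpoint_iff.2 ⟨p, q, hp, hq, fun hc =>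
      (eq_or_adj_of_conn htrans hc).elim hpq hnpq⟩
    have hG' : ∀ x y z, (G.completeNeighbors (f₁ a)).Adj x y →
        (G.completeNeighbors (f₁ a)).Adj y z → x ≠ z → (G.completeNeighbors (f₁ a)).Adj x z := by
      rintro x y z hxy hyz hxz
      by_cases hy : y = f₁ a
      · subst hy
        have h1 := hxy.resolve_right fun h => G.irrefl h.2.2
        have h2 := hyz.resolve_right fun h => G.irrefl h.2.1
        exact Or.inr ⟨hxz, h1.symm, h2⟩
      rcases hxy with hxy | ⟨-, hx, hy'⟩ <;> rcases hyz with hyz | ⟨-, hy'', hz⟩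
      · exact Or.inl (htrans x y z hy hxy hyz hxz)
      · by_cases hx : x = f₁ a
        · exact Or.inl (hx ▸ hz)
        · exact Or.inr ⟨hxz, htrans' x y hy hx hxy hy'', hz⟩
      · by_cases hz : z = f₁ a
        · exact Or.inl (hz ▸ hx.symm)
        · exact Or.inr ⟨hxz, hx, htrans' z y hy hz hyz.symm hy'⟩
      · exact Or.inr ⟨hxz, hx, hz⟩
    refine of_cutpoint G (h.isUnmixed K (of_complete H₁ h₁).isUnmixed
      (of_complete H₂ h₂).isUnmixed) (f₁ a) hcut ?_ ?_ ?_
    · exact of_complete _ (isClique_supp_of_trans fun x y z hxy hyz hxz =>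
        htrans x.1 y.1 z.1 y.2 hxy hyz fun h => hxz (Subtype.ext h))
    · exact of_complete _ (isClique_supp_of_trans hG')
    · exact of_complete _ (isClique_supp_of_trans fun x y z hxy hyz hxz =>
        hG' x.1 y.1 z.1 hxy hyz fun h => hxz (Subtype.ext h))

lemma ne_of_isCutpoint {W : Type*} [Finite W] {H : SimpleGraph W} {a w : W}
    (ha : ∀ x y, H.Adj a x → H.Adj a y → x ≠ y → H.Adj x y) (hw : H.IsCutpoint w) : w ≠ a :=
  fun h => notMem_of_isCutset_of_clique ha hw h.symm

lemma of_isGluing_of_complete_left {H₁ : SimpleGraph W₁}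
    (h₁ : ∀ c : H₁.ConnectedComponent, H₁.IsClique c.supp) {H₂ : SimpleGraph W₂}
    (h₂ : H₂.StronglyUnmixed K) : ∀ {V : Type u} [Finite V] {G : SimpleGraph V} {f₁ : H₁ ↪g G}
    {f₂ : H₂ ↪g G} {a : W₁} {b : W₂}, IsGluing f₁ f₂ a b → G.StronglyUnmixed K := by
  induction h₂ with
  | of_complete H₂ h₂ => exact fun h => of_isGluing_of_complete h h₁ h₂
  | of_cutpoint H₂ hH₂ w hw _ _ _ ih₁ ih₂ ih₃ =>
    intro V _ G f₁ f₂ a b h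
    have := Finite.of_injective f₁ f₁.injective
    have := Finite.of_injective f₂ f₂.injective
    have hwb := ne_of_isCutpoint h.clique₂ hw
    exact of_cutpoint G (h.isUnmixed K (of_complete H₁ h₁).isUnmixed hH₂) _
      (h.symm.isCutpoint_map hw) (ih₁ (h.symm.removeVert hwb).symm)
      (ih₂ (h.symm.completeNeighbors hwb).symm)
      (ih₃ ((h.symm.completeNeighbors hwb).removeVert hwb).symm)

/-- A cutpoint of `H₁` is never the gluing vertex, so it is a cutpoint of `G` and the three
operations act on `H₁` while `H₂` stays intact. -/
lemma of_isGluing {H₁ : SimpleGraph W₁} (h₁ : H₁.StronglyUnmixed K) {H₂ : SimpleGraph W₂}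
    (h₂ : H₂.StronglyUnmixed K) : ∀ {V : Type u} [Finite V] {G : SimpleGraph V} {f₁ : H₁ ↪g G}
    {f₂ : H₂ ↪g G} {a : W₁} {b : W₂}, IsGluing f₁ f₂ a b → G.StronglyUnmixed K := by
  induction h₁ with
  | of_complete H₁ h₁ => exact fun h => of_isGluing_of_complete_left h₁ h₂ h
  | of_cutpoint H₁ hH₁ w hw _ _ _ ih₁ ih₂ ih₃ =>
    intro V _ G f₁ f₂ a b h
    have := Finite.of_injective f₁ f₁.injective
    have := Finite.of_injective f₂ f₂.injective
    have hwa := ne_of_isCutpoint h.clique₁ hw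
    exact of_cutpoint G (h.isUnmixed K hH₁ h₂.isUnmixed) _ (h.isCutpoint_map hw)
      (ih₁ (h.removeVert hwa)) (ih₂ (h.completeNeighbors hwa))
      (ih₃ ((h.completeNeighbors hwa).removeVert hwa))

end Gluing

end StronglyUnmixed

/-! ### Accessibility of gluings -/

section Accessible

variable {K : Type*} [Field K] {V W₁ W₂ : Type*} [Finite V] {G : SimpleGraph V}
  {H₁ : SimpleGraph W₁} {H₂ : SimpleGraph W₂} {f₁ : H₁ ↪g G} {f₂ : H₂ ↪g G} {a : W₁} {b : W₂}

lemma Accessible.of_isGluing_left (h : IsGluing f₁ f₂ a b) (hG : G.Accessible K) :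
    H₁.Accessible K := by
  have := Finite.of_injective f₁ f₁.injective
  refine ⟨h.isFreePart.isUnmixed K hG.1, fun T hT hne => ?_⟩
  have haT := notMem_of_isCutset_of_clique h.clique₁ hT
  obtain ⟨_, ⟨t, ht, rfl⟩, hc⟩ := hG.2 _ (h.isFreePart.isCutset_image hT) (hne.image f₁)
  refine ⟨t, ht, ?_⟩
  have hp := h.isCutset_part hc
  have : IsGluing.part f₁ a (f₁ '' T \ {f₁ t}) = T \ {t} := by
    ext x
    simp only [IsGluing.part, Set.mem_ofPred_eq, Set.mem_sdiff, Set.mem_singleton_iff,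
      f₁.injective.eq_iff, f₁.injective.mem_set_image]
    exact ⟨fun h => h.2, fun h => ⟨fun h' => haT (h' ▸ h.1), h⟩⟩
  rwa [this] at hp

lemma IsGluing.exists_isCutset_sdiff (h : IsGluing f₁ f₂ a b) (h₁ : H₁.Accessible K) {T : Set V}
    (hT : G.IsCutset T) (ha : f₁ a ∉ T) (hne : (IsGluing.part f₁ a T).Nonempty) :
    ∃ t ∈ T, G.IsCutset (T \ {t}) := by
  obtain ⟨t, ht, hc⟩ := h₁.2 _ (h.isCutset_part hT) hne
  refine ⟨f₁ t, ht.2, ?_⟩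
  have hu := h.isCutset_union hc (h.symm.isCutset_part hT)
  have hb : b ∉ IsGluing.part f₂ b T := fun h => h.1 rfl
  have hd : f₁ t ∉ f₂ '' IsGluing.part f₂ b T := h.notMem_image hb t
  have : f₁ '' (IsGluing.part f₁ a T \ {t}) ∪ f₂ '' IsGluing.part f₂ b T = T \ {f₁ t} := by
    rw [← Set.sdiff_singleton_eq_self ha, ← h.part_image_diff, Set.union_sdiff_distrib,
      Set.sdiff_singleton_eq_self hd, Set.image_sdiff f₁.injective, Set.image_singleton,
      h.part_image_diff, Set.sdiff_singleton_eq_self ha]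
  rwa [this] at hu

/-- If the common vertex lies in the cutset, it can be removed, since the two parts are cutsets
whose union is a cutset. Otherwise some part is nonempty and accessibility of that side supplies the
vertex. -/
lemma Accessible.of_isGluing (h : IsGluing f₁ f₂ a b) (h₁ : H₁.Accessible K)
    (h₂ : H₂.Accessible K) : G.Accessible K := by
  refine ⟨h.isUnmixed K h₁.1 h₂.1, fun T hT hne => ?_⟩
  by_cases ha : f₁ a ∈ T
  · refine ⟨f₁ a, ha, ?_⟩
    rw [← h.part_image_diff]
    exact h.isCutset_union (h.isCutset_part hT) (h.symm.isCutset_part hT)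
  · obtain ⟨x, hx⟩ := hne
    rw [← Set.sdiff_singleton_eq_self ha, ← h.part_image_diff] at hx
    rcases hx with ⟨y, hy, -⟩ | ⟨y, hy, -⟩
    · exact h.exists_isCutset_sdiff h₁ hT ha ⟨y, hy⟩
    · exact h.symm.exists_isCutset_sdiff h₂ hT (h.eq ▸ ha) ⟨y, hy⟩

end Accessible

/-! ### From free vertices and subgraphs to gluings -/

/-- Every edge at `v` extends to a maximal clique, which must be the unique one through `v`. -/
lemma IsFreeVertex.adj {V : Type*} [Finite V] {G : SimpleGraph V} {v : V} (h : G.IsFreeVertex v)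
    (x y : V) (hx : G.Adj v x) (hy : G.Adj v y) (hxy : x ≠ y) : G.Adj x y := by
  obtain ⟨C, ⟨hC, _⟩, huniq⟩ := h
  have key : ∀ z, G.Adj v z → z ∈ C := by
    intro z hz
    have hcl : G.IsClique {v, z} := by
      rw [isClique_pair]
      exact fun _ => hz
    obtain ⟨D, hD, hmax⟩ := (Set.toFinite {s : Set V | G.IsClique s}).exists_le_maximal hcl
    rw [← huniq D ⟨hmax, hD (Or.inl rfl)⟩]
    exact hD (Or.inr rfl)
  exact hC.prop (key x hx) (key y hy) hxy

/-- A subgraph of `G` containing all edges of `G` between its vertices is embedded. -/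
def Subgraph.embedding {V : Type*} {G : SimpleGraph V} (G₁ : G.Subgraph)
    (h : ∀ x ∈ G₁.verts, ∀ y ∈ G₁.verts, G.Adj x y → G₁.Adj x y) : G₁.coe ↪g G where
  toFun := Subtype.val
  inj' := Subtype.val_injective
  map_rel_iff' := by
    intro x y
    exact ⟨h x.1 x.2 y.1 y.2, fun h' => G₁.adj_sub h'⟩

end SimpleGraph

theorem mainTheorem9 {K : Type*} [Field K] {V : Type*} [Finite V] (G : SimpleGraph V)
    (G₁ G₂ : G.Subgraph) (hunion : G₁ ⊔ G₂ = ⊤) (v : V) (hinter : G₁.verts ∩ G₂.verts = {v})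
    (hv₁ : v ∈ G₁.verts) (hv₂ : v ∈ G₂.verts)
    (hfree₁ : G₁.coe.IsFreeVertex ⟨v, hv₁⟩) (hfree₂ : G₂.coe.IsFreeVertex ⟨v, hv₂⟩) :
    ((G₁.coe.StronglyUnmixed K ∧ G₂.coe.StronglyUnmixed K) ↔ G.StronglyUnmixed K) ∧
    ((G₁.coe.Accessible K ∧ G₂.coe.Accessible K) ↔ G.Accessible K) := by
  have hadj : ∀ x y, G.Adj x y → G₁.Adj x y ∨ G₂.Adj x y := by
    intro x y hxy
    rw [← SimpleGraph.Subgraph.sup_adj, hunion]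
    exact hxy
  have heq : ∀ x, x ∈ G₁.verts → x ∈ G₂.verts → x = v := fun x h₁ h₂ => by
    have : x ∈ ({v} : Set V) := hinter ▸ ⟨h₁, h₂⟩
    exact this
  -- An edge of `G₂` with both ends in `G₁` would have both ends equal to `v`; hence each side is an
  -- induced subgraph.
  have hi₁ : ∀ x ∈ G₁.verts, ∀ y ∈ G₁.verts, G.Adj x y → G₁.Adj x y := fun x hx y hy h =>
    (hadj x y h).resolve_right fun h' => h.ne
      ((heq x hx (G₂.edge_vert h')).trans (heq y hy (G₂.edge_vert h'.symm)).symm)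
  have hi₂ : ∀ x ∈ G₂.verts, ∀ y ∈ G₂.verts, G.Adj x y → G₂.Adj x y := fun x hx y hy h =>
    (hadj x y h).resolve_left fun h' => h.ne
      ((heq x (G₁.edge_vert h') hx).trans (heq y (G₁.edge_vert h'.symm) hy).symm)
  have hglue : SimpleGraph.IsGluing (G₁.embedding hi₁) (G₂.embedding hi₂) ⟨v, hv₁⟩ ⟨v, hv₂⟩ :=
    { eq := rfl
      cover := by
        intro x
        have hx : x ∈ (G₁ ⊔ G₂).verts := by rw [hunion]; trivial
        rcases hx with hx | hx
        · exact Or.inl ⟨⟨x, hx⟩, rfl⟩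
        · exact Or.inr ⟨⟨x, hx⟩, rfl⟩
      inter := by
        rintro ⟨x, hx⟩ ⟨y, hy⟩ rfl
        exact Subtype.ext (heq x hx hy)
      adj := by
        rintro ⟨x, hx⟩ ⟨y, hy⟩ hxy
        rcases hadj x y hxy with h | h
        · exact Or.inr (Subtype.ext (heq y (G₁.edge_vert h.symm) hy))
        · exact Or.inl (Subtype.ext (heq x hx (G₂.edge_vert h)))
      clique₁ := hfree₁.adj
      clique₂ := hfree₂.adj }
  exact ⟨⟨fun h => SimpleGraph.StronglyUnmixed.of_isGluing h.1 h.2 hglue, fun h =>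
    ⟨h.of_isFreePart hglue.isFreePart, h.of_isFreePart hglue.symm.isFreePart⟩⟩,
    ⟨fun h => SimpleGraph.Accessible.of_isGluing hglue h.1 h.2, fun h =>
    ⟨h.of_isGluing_left hglue, h.of_isGluing_left hglue.symm⟩⟩⟩
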